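/- Let $G=\mathrm{SL}(2,\mathbb C)$ and let $P\subset G$ be the subgroup of upper triangular matrices with $1$'s on the diagonal. Let $M$ be a connected compact $3$-manifold with non-empty boundary and let $\mathcal T$ be a topological ideal triangulation of $M$. Thus $M$ is obtained from finitely many truncated tetrahedra by gluing their hexagonal faces in pairs by affine maps induced by bijections of the vertices, no edge being glued to itself with reversed orientation, and $\partial M$ is the union of the triangular faces. Let $\overline{\mathcal T}$ denote this decomposition of $M$ into truncated tetrahedra and $V(\overline{\mathcal T})$ its set of vertices. An edge of $\overline{\mathcal T}$ is *short* if it lies on a triangular face and *long* otherwise. Fix a base point of $M$. *Decorated representations.* A homomorphism $\rho\colon\pi_1(M)\to G$ is *boundary-unipotent* if it takes each peripheral subgroup (the image of the fundamental group of a component of $\partial M$, for any path joining the base point to it) into a conjugate of $P$. Let $I(\widetilde M)$ be the set of boundary components of the universal cover $\widetilde M$, on which $\pi_1(M)$ acts by deck transformations. A *decorated boundary-unipotent representation* is a pair $(\rho,D)$ of a boundary-unipotent $\rho\colon\pi_1(M)\to G$ and a $\rho$-equivariant map $D\colon I(\widetilde M)\to G/P$; the pairs $(\rho,D)$ and $(g\rho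 g^{-1},gD)$, $g\in G$, are considered equal. *Bruhat cocycles.* A *Bruhat cocycle* $\tau$ on $\overline{\mathcal T}$ is a labeling of the oriented edges of $\overline{\mathcal T}$ by elements of $G$ such that the product of the labels around each triangular and each hexagonal face is the identity, reversing an edge inverts its label, short edges are labeled by elements of $P$, and each long edge is labeled by a diagonal or a counter-diagonal matrix. A map $\eta\colon V(\overline{\mathcal T})\to P$ acts by $(\eta\tau)(e)=\eta(e_0)^{-1}\tau(e)\eta(e_1)$, where $e_0$ and $e_1$ are the starting and the ending vertex of $e$, and it *preserves* $\tau$ if $\eta\tau$ is again a Bruhat cocycle. Two Bruhat cocycles $\tau,\tau'$ are equal *up to coboundaries preserving* $\tau$ if $\tau'=\eta\tau$ for some $\eta\colon V(\overline{\mathcal T})\to P$. *Compatibility.* For an edge path $p$ of $\overline{\mathcal T}$, let $\tau(p)$ be the product of the labels along $p$. The cocycle $\tau$ is *compatible* with $(\rho,D)$ if there are a vertex $v\in V(\overline{\mathcal T})$, a path $c$ in $M$ from the base point to $v$ and a $g\in G$ such that $\rho([c\,p\,c^{-1}])=g\,\tau(p)\,g^{-1}$ for every closed edge path $p$ at $v$,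 and such that, for every edge path $p$ starting at $v$, the map $D$ takes the boundary component of $\widetilde M$ that contains the endpoint of the lift of $c\,p$ (starting at the base point of $\widetilde M$) to the coset $g\,\tau(p)P$. **Theorem.** There is a one-to-one correspondence $$\left\{\text{decorated boundary-unipotent }\mathrm{SL}(2,\mathbb C)\text{-representations}\right\}\longleftrightarrow\left\{\text{Bruhat cocycles }\tau\text{ on }\overline{\mathcal T}\text{ up to coboundaries preserving }\tau\right\},$$ under which the class of $(\rho,D)$ corresponds to the class of $\tau$ if and only if $\tau$ is compatible with $(\rho,D)$. -/

import Mathlib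

noncomputable section

namespace Ptolemy

/-! ### The group `SL(2, ℂ)` and its relevant subsets -/

/-- The group `G = SL(2, ℂ)`. -/
abbrev SL2C : Type := Matrix.SpecialLinearGroup (Fin 2) ℂ

/-- The subgroup `P` of upper triangular matrices with `1`'s on the diagonal. -/
def P : Subgroup SL2C where
  carrier := {g | g 0 0 = 1 ∧ g 1 1 = 1 ∧ g 1 0 = 0}
  one_mem' := by simp
  mul_mem' := by
    rintro a b ⟨ha, ha', ha''⟩ ⟨hb, hb', hb''⟩
    simp [Matrix.mul_apply, Fin.sum_univ_two, *]
  inv_mem' := by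
    rintro a ⟨ha, ha', ha''⟩
    rw [Matrix.SpecialLinearGroup.SL2_inv_expl a]
    exact ⟨ha', ha, by simp [ha'']⟩

/-- Diagonal matrices. -/
def IsDiagonal (g : SL2C) : Prop := g 0 1 = 0 ∧ g 1 0 = 0

/-- Counter-diagonal matrices. -/
def IsCounterDiagonal (g : SL2C) : Prop := g 0 0 = 0 ∧ g 1 1 = 0

/-! ### The truncated simplex -/

/-- The truncated tetrahedron: the standard `3`-simplex (in barycentric coordinates) with a small
neighborhood of each vertex chopped off.  Its four triangular faces are `{x k = 2/3}` and its four
hexagonal faces are `{x i = 0}`. -/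
def TruncatedSimplex : Set (Fin 4 → ℝ) :=
  {x | x ∈ stdSimplex ℝ (Fin 4) ∧ ∀ k, x k ≤ 2 / 3}

theorem convex_truncatedSimplex : Convex ℝ TruncatedSimplex := by
  intro x hx y hy a b ha hb hab
  refine ⟨convex_stdSimplex ℝ (Fin 4) hx.1 hy.1 ha hb hab, fun k => ?_⟩
  have h1 := mul_le_mul_of_nonneg_left (hx.2 k) ha
  have h2 := mul_le_mul_of_nonneg_left (hy.2 k) hb
  simp only [Pi.add_apply, Pi.smul_apply, smul_eq_mul]
  nlinarith

/-- A vertex of the truncated simplex: the endpoint near the vertex `near` of the long edge joining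
`near` to `dir`. -/
structure Corner where
  near : Fin 4
  dir : Fin 4
  ne : near ≠ dir

/-- The position of a vertex of the truncated simplex. -/
def Corner.point (c : Corner) : TruncatedSimplex :=
  ⟨fun a => if a = c.near then 2 / 3 else if a = c.dir then 1 / 3 else 0, by
    obtain ⟨k, i, h⟩ := c
    refine ⟨⟨fun a => ?_, ?_⟩, fun a => ?_⟩
    · dsimp only; split_ifs <;> norm_num
    · fin_cases k <;> fin_cases i <;> simp [Fin.sum_univ_four] at h ⊢ <;> norm_num
    · dsimp only; split_ifs <;> norm_num⟩

/-- The straight path between two points of the truncated simplex. -/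
def straightPath (x y : TruncatedSimplex) : Path x y where
  toFun s := ⟨AffineMap.lineMap x.1 y.1 (s : ℝ),
    convex_truncatedSimplex.lineMap_mem x.2 y.2 s.2⟩
  continuous_toFun := by
    refine Continuous.subtype_mk ?_ _
    exact AffineMap.lineMap_continuous.comp continuous_subtype_val
  source' := by simp
  target' := by simp

/-- The oriented edges of `n` truncated simplices.  `long t i j` is the long edge of the `t`-th
simplex from vertex `i` to vertex `j`; `short t k i j` is the short edge near vertex `k` parallel to
the edge from `i` to `j`. -/
inductive OrientedEdge (n : ℕ) : Type
  | long (t : Fin n) (i j : Fin 4) (hij : i ≠ j) : OrientedEdge n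
  | short (t : Fin n) (k i j : Fin 4) (hki : k ≠ i) (hkj : k ≠ j) (hij : i ≠ j) : OrientedEdge n

namespace OrientedEdge

variable {n : ℕ}

/-- The simplex to which an edge belongs. -/
def tet : OrientedEdge n → Fin n
  | long t _ _ _ => t
  | short t _ _ _ _ _ _ => t

/-- The starting vertex of an oriented edge. -/
def source : OrientedEdge n → Corner
  | long _ i j h => ⟨i, j, h⟩
  | short _ k i _ hki _ _ => ⟨k, i, hki⟩

/-- The ending vertex of an oriented edge. -/
def target : OrientedEdge n → Corner
  | long _ i j h => ⟨j, i, h.symm⟩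
  | short _ k _ j _ hkj _ => ⟨k, j, hkj⟩

/-- The same edge with the opposite orientation. -/
def reverse : OrientedEdge n → OrientedEdge n
  | long t i j h => long t j i h.symm
  | short t k i j hki hkj hij => short t k j i hkj hki hij.symm

end OrientedEdge

/-! ### Topological ideal triangulations -/

/-- A pairing of the faces of `n` tetrahedra.  The face of the `t`-th tetrahedron opposite to its
vertex `f` is glued to the face of `adj t f` opposite to the vertex `perm t f f`, a vertex `a ≠ f`
being glued to the vertex `perm t f a`. -/
structure FacePairing (n : ℕ) where
  adj : Fin n → Fin 4 → Fin n
  perm : Fin n → Fin 4 → Equiv.Perm (Fin 4)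
  /-- The pairing is an involution... -/
  adj_adj : ∀ t f, adj (adj t f) (perm t f f) = t
  perm_perm : ∀ t f, perm (adj t f) (perm t f f) = (perm t f)⁻¹
  /-- ...without fixed faces. -/
  no_fixed_face : ∀ t f, (adj t f, perm t f f) ≠ (t, f)

namespace FacePairing

variable {n : ℕ} (F : FacePairing n)

/-- Two points on paired hexagonal faces that are glued to each other. -/
def PointGlued (p q : Fin n × TruncatedSimplex) : Prop :=
  ∃ f : Fin 4, p.2.1 f = 0 ∧ q.1 = F.adj p.1 f ∧ ∀ a, q.2.1 (F.perm p.1 f a) = p.2.1 a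

/-- Two oriented edges on paired hexagonal faces that are glued to each other. -/
inductive EdgeGlued : OrientedEdge n → OrientedEdge n → Prop
  | long (t : Fin n) (f i j : Fin 4) (hi : f ≠ i) (hj : f ≠ j) (hij : i ≠ j) :
      EdgeGlued (.long t i j hij)
        (.long (F.adj t f) (F.perm t f i) (F.perm t f j) ((F.perm t f).injective.ne hij))
  | short (t : Fin n) (f k i j : Fin 4) (hk : f ≠ k) (hi : f ≠ i) (hj : f ≠ j)
      (hki : k ≠ i) (hkj : k ≠ j) (hij : i ≠ j) :
      EdgeGlued (.short t k i j hki hkj hij)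
        (.short (F.adj t f) (F.perm t f k) (F.perm t f i) (F.perm t f j)
          ((F.perm t f).injective.ne hki) ((F.perm t f).injective.ne hkj)
          ((F.perm t f).injective.ne hij))

end FacePairing

/-- A (topological ideal) triangulation of `M`, given by the decomposition of `M` into finitely many
truncated simplices: `M` is the space obtained from truncated simplices by gluing their hexagonal
faces in pairs.  No edge may be glued to itself with reversed orientation; this is what makes the
glued space a compact `3`-manifold, whose boundary is the union of the triangular faces. -/
structure IdealTriangulation (M : Type*) [TopologicalSpace M] where
  /-- The number of simplices. -/
  n : ℕ
  pairing : FacePairing n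
  no_reversed_edge : ∀ e, ¬ Relation.EqvGen pairing.EdgeGlued e e.reverse
  /-- The characteristic maps of the truncated simplices. -/
  cell : Fin n → TruncatedSimplex → M
  isQuotientMap_cell :
    Topology.IsQuotientMap (fun p : Fin n × TruncatedSimplex => cell p.1 p.2)
  cell_eq_cell_iff : ∀ p q : Fin n × TruncatedSimplex,
    cell p.1 p.2 = cell q.1 q.2 ↔ Relation.EqvGen pairing.PointGlued p q

namespace IdealTriangulation

variable {M : Type*} [TopologicalSpace M] (T : IdealTriangulation M)

theorem continuous_cell (t : Fin T.n) : Continuous (T.cell t) :=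
  T.isQuotientMap_cell.continuous.comp (Continuous.prodMk_right t)

/-- The boundary of `M`: the union of the triangular faces. -/
def boundary : Set M := {m | ∃ (t : Fin T.n) (x : TruncatedSimplex) (k : Fin 4),
  x.1 k = 2 / 3 ∧ T.cell t x = m}

/-- The set of vertices of the decomposition of `M` into truncated simplices. -/
def vertices : Set M := {m | ∃ (t : Fin T.n) (c : Corner), T.cell t c.point = m}

theorem vertices_subset_boundary : T.vertices ⊆ T.boundary := by
  rintro m ⟨t, c, rfl⟩
  exact ⟨t, c.point, c.near, by simp [Corner.point], rfl⟩

/-- The starting vertex of an oriented edge. -/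
def source (e : OrientedEdge T.n) : T.vertices := ⟨T.cell e.tet e.source.point, _, _, rfl⟩

/-- The ending vertex of an oriented edge. -/
def target (e : OrientedEdge T.n) : T.vertices := ⟨T.cell e.tet e.target.point, _, _, rfl⟩

/-- An oriented edge as a path in `M`. -/
def edge (e : OrientedEdge T.n) : Path (T.source e : M) (T.target e) :=
  (straightPath e.source.point e.target.point).map (T.continuous_cell e.tet)

/-- Edge paths of the decomposition of `M` into truncated simplices. -/
inductive EdgePath : T.vertices → T.vertices → Type _
  | nil (v : T.vertices) : EdgePath v v
  | cons {v w : T.vertices} (e : OrientedEdge T.n) (h : T.source e = v)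
      (p : EdgePath (T.target e) w) : EdgePath v w

/-- The homotopy class of paths in `M` represented by an edge path. -/
def EdgePath.homotopyClass : {v w : T.vertices} → T.EdgePath v w →
    Path.Homotopic.Quotient (v : M) (w : M)
  | _, _, .nil v => .refl (v : M)
  | _, _, .cons e h p =>
      ((Path.Homotopic.Quotient.mk (T.edge e)).trans p.homotopyClass).cast
        (congrArg Subtype.val h).symm rfl

end IdealTriangulation

/-! ### Decorated boundary-unipotent representations

`M` is a space with a base point `x₀`, and `S` is its boundary. -/

section Decorations

variable {M : Type*} [TopologicalSpace M]

/-- The fundamental group, multiplied by concatenation of paths (in that order).  The multiplication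
of `FundamentalGroup M x₀` is the opposite one. -/
abbrev PiOne (M : Type*) [TopologicalSpace M] (x₀ : M) : Type _ := (FundamentalGroup M x₀)ᵐᵒᵖ

/-- The element of the fundamental group represented by a homotopy class of loops. -/
def PiOne.ofLoop {x₀ : M} (a : Path.Homotopic.Quotient x₀ x₀) : PiOne M x₀ :=
  MulOpposite.op (FundamentalGroup.fromPath a)

/-- The homotopy class of loops underlying an element of the fundamental group. -/
def PiOne.loop {x₀ : M} (a : PiOne M x₀) : Path.Homotopic.Quotient x₀ x₀ :=
  FundamentalGroup.toPath a.unop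

theorem PiOne.ofLoop_trans {x₀ : M} (a b : Path.Homotopic.Quotient x₀ x₀) :
    PiOne.ofLoop (a.trans b) = PiOne.ofLoop a * PiOne.ofLoop b := rfl

theorem PiOne.loop_mul {x₀ : M} (a b : PiOne M x₀) :
    (a * b).loop = a.loop.trans b.loop := rfl

/-- The homotopy class in `M` of a homotopy class of paths in the subspace `S`. -/
def pushSub {S : Set M} {b b' : S} (d : Path.Homotopic.Quotient b b') :
    Path.Homotopic.Quotient (b : M) (b' : M) :=
  d.map ⟨Subtype.val, continuous_subtype_val⟩

/-- The points of the universal cover of `M` lying over `S`.  The universal cover is modelled, as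
usual, by homotopy classes of paths starting at `x₀`. -/
abbrev CoverPoint (S : Set M) (x₀ : M) : Type _ :=
  Σ b : S, Path.Homotopic.Quotient x₀ (b : M)

/-- Two points over `S` are in the same component of the preimage of `S` in the universal cover when
they are joined by the lift of a path in `S`. -/
def coverSetoid (S : Set M) (x₀ : M) : Setoid (CoverPoint S x₀) where
  r p q := ∃ d : Path.Homotopic.Quotient p.1 q.1, q.2 = p.2.trans (pushSub d)
  iseqv :=
    { refl := fun p => ⟨.refl p.1, (Path.Homotopic.Quotient.trans_refl p.2).symm⟩
      symm := by
        rintro p q ⟨d, hd⟩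
        refine ⟨d.symm, ?_⟩
        have : pushSub d.symm = (pushSub d).symm := by
          induction d using Path.Homotopic.Quotient.ind with | mk d => rfl
        rw [hd, this, Path.Homotopic.Quotient.trans_assoc, Path.Homotopic.Quotient.trans_symm,
          Path.Homotopic.Quotient.trans_refl]
      trans := by
        rintro p q r ⟨d, hd⟩ ⟨d', hd'⟩
        refine ⟨d.trans d', ?_⟩
        have : pushSub (d.trans d') = (pushSub d).trans (pushSub d') :=
          (FundamentalGroupoid.map
            (⟨Subtype.val, continuous_subtype_val⟩ : C(S, M))).map_comp
              (X := ⟨p.1⟩) (Y := ⟨q.1⟩) (Z := ⟨r.1⟩) d d'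
        rw [hd', hd, this, Path.Homotopic.Quotient.trans_assoc] }

/-- The ideal points of the universal cover: the components of the preimage of the boundary. -/
def IdealPoint (S : Set M) (x₀ : M) : Type _ := Quotient (coverSetoid S x₀)

/-- The ideal point given by a homotopy class of paths from the base point to the boundary. -/
def IdealPoint.mk {S : Set M} {x₀ : M} (b : S) (c : Path.Homotopic.Quotient x₀ (b : M)) :
    IdealPoint S x₀ :=
  Quotient.mk (coverSetoid S x₀) ⟨b, c⟩

/-- The action of the fundamental group on the ideal points by deck transformations. -/
def IdealPoint.translate {S : Set M} {x₀ : M} (a : PiOne M x₀) :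
    IdealPoint S x₀ → IdealPoint S x₀ :=
  Quotient.lift (fun p : CoverPoint S x₀ => IdealPoint.mk p.1 (a.loop.trans p.2)) (by
    rintro p q ⟨d, hd⟩
    exact Quotient.sound (s := coverSetoid S x₀)
      ⟨d, by rw [hd, Path.Homotopic.Quotient.trans_assoc]⟩)

/-- A representation is boundary-unipotent if it takes each peripheral subgroup (the image of the
fundamental group of a boundary component under the map given by a path to that component) into a
conjugate of `P`. -/
def IsBoundaryUnipotent (S : Set M) {x₀ : M} (ρ : PiOne M x₀ →* SL2C) : Prop :=
  ∀ (b : S) (c : Path.Homotopic.Quotient x₀ (b : M)), ∃ g : SL2C,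
    ∀ d : Path.Homotopic.Quotient b b,
      g⁻¹ * ρ (PiOne.ofLoop ((c.trans (pushSub d)).trans c.symm)) * g ∈ P

/-- A boundary-unipotent representation together with a decoration, i.e. an equivariant assignment
of `P`-cosets to the ideal points. -/
structure DecoratedRep (S : Set M) (x₀ : M) where
  ρ : PiOne M x₀ →* SL2C
  boundaryUnipotent : IsBoundaryUnipotent S ρ
  D : IdealPoint S x₀ → SL2C ⧸ P
  equivariant : ∀ (a : PiOne M x₀) (p : IdealPoint S x₀), D (p.translate a) = ρ a • D p

/-- Decorated representations are considered equal if they differ by left multiplication of the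
decoration (and the corresponding conjugation of the representation) by an element of `G`. -/
instance decoratedRepSetoid (S : Set M) (x₀ : M) : Setoid (DecoratedRep S x₀) where
  r X Y := ∃ g : SL2C, (∀ a, Y.ρ a = g * X.ρ a * g⁻¹) ∧ ∀ p, Y.D p = g • X.D p
  iseqv :=
    { refl := fun X => ⟨1, by simp, by simp⟩
      symm := by
        rintro X Y ⟨g, h, h'⟩
        exact ⟨g⁻¹, fun a => by rw [h]; group, fun p => by rw [h', inv_smul_smul]⟩
      trans := by
        rintro X Y Z ⟨g, h, h'⟩ ⟨k, hk, hk'⟩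
        exact ⟨k * g, fun a => by rw [hk, h]; group, fun p => by rw [hk', h', mul_smul]⟩ }

end Decorations

/-! ### Bruhat cocycles -/

section Cocycles

variable {M : Type*} [TopologicalSpace M]

/-- A Bruhat cocycle on the decomposition of `M` into truncated simplices. -/
structure BruhatCocycle (T : IdealTriangulation M) where
  /-- The labeling of the oriented edges. -/
  label : OrientedEdge T.n → SL2C
  /-- The labelings of identified edges agree. -/
  label_glued : ∀ e e', T.pairing.EdgeGlued e e' → label e = label e'
  /-- Flipping the orientation replaces a labeling by its inverse. -/
  label_reverse : ∀ e, label e.reverse = (label e)⁻¹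
  /-- The product around each triangular face is the identity. -/
  triangle : ∀ (t : Fin T.n) (k i j l : Fin 4) (hki : k ≠ i) (hkj : k ≠ j) (hkl : k ≠ l)
    (hij : i ≠ j) (hjl : j ≠ l) (hli : l ≠ i),
    label (.short t k i j hki hkj hij) * label (.short t k j l hkj hkl hjl) *
      label (.short t k l i hkl hki hli) = 1
  /-- The product around each hexagonal face is the identity. -/
  hexagon : ∀ (t : Fin T.n) (i j k : Fin 4) (hij : i ≠ j) (hjk : j ≠ k) (hki : k ≠ i),
    label (.long t i j hij) * label (.short t j i k hij.symm hjk hki.symm) *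
      label (.long t j k hjk) * label (.short t k j i hjk.symm hki hij.symm) *
      label (.long t k i hki) * label (.short t i k j hki.symm hij hjk.symm) = 1
  /-- Short edges are labeled by elements of `P`. -/
  short_mem : ∀ (t : Fin T.n) (k i j : Fin 4) (hki : k ≠ i) (hkj : k ≠ j) (hij : i ≠ j),
    label (.short t k i j hki hkj hij) ∈ P
  /-- Long edges are labeled by diagonal or counter-diagonal elements. -/
  long_mem : ∀ (t : Fin T.n) (i j : Fin 4) (hij : i ≠ j),
    IsDiagonal (label (.long t i j hij)) ∨ IsCounterDiagonal (label (.long t i j hij))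

/-- Two Bruhat cocycles `τ`, `τ'` are equivalent if `τ' = ητ` for a zero-cochain `η` with values in
`P` (which thus preserves `τ`), acting by `ητ(e) = η(e₀)⁻¹ τ(e) η(e₁)`. -/
instance bruhatSetoid (T : IdealTriangulation M) : Setoid (BruhatCocycle T) where
  r τ τ' := ∃ η : T.vertices → P, ∀ e : OrientedEdge T.n,
    τ'.label e = (η (T.source e) : SL2C)⁻¹ * τ.label e * (η (T.target e) : SL2C)
  iseqv :=
    { refl := fun τ => ⟨fun _ => 1, fun e => by simp⟩
      symm := by
        rintro τ τ' ⟨η, h⟩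
        exact ⟨fun v => (η v)⁻¹, fun e => by rw [h]; push_cast; group⟩
      trans := by
        rintro τ τ' τ'' ⟨η, h⟩ ⟨ζ, h'⟩
        exact ⟨fun v => η v * ζ v, fun e => by rw [h', h]; push_cast; group⟩ }

namespace BruhatCocycle

variable {T : IdealTriangulation M} (τ : BruhatCocycle T)

/-- The product of the labels along an edge path. -/
def along : {v w : T.vertices} → T.EdgePath v w → SL2C
  | _, _, .nil _ => 1
  | _, _, .cons e _ p => τ.label e * along p

/-- The cocycle `τ` is compatible with a decorated representation `(ρ, D)` if the latter is the one
determined by `τ`: after the choice of a vertex `v` and of a path `c` from the base point to `v`,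
and up to an element `g` of `G`, the value of `ρ` on a loop given by an edge path at `v` is the
product of the labels along this edge path, and the coset assigned by `D` to the ideal point near
the end of an edge path starting at `v` is the coset of the product of the labels along it. -/
def IsCompatible {x₀ : M} (X : DecoratedRep T.boundary x₀) : Prop :=
  ∃ (v : T.vertices) (c : Path.Homotopic.Quotient x₀ (v : M)) (g : SL2C),
    (∀ p : T.EdgePath v v,
      X.ρ (PiOne.ofLoop ((c.trans p.homotopyClass).trans c.symm)) = g * τ.along p * g⁻¹) ∧
    ∀ (w : T.vertices) (p : T.EdgePath v w),
      X.D (IdealPoint.mk ⟨w, T.vertices_subset_boundary w.2⟩ (c.trans p.homotopyClass)) =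
        g • (QuotientGroup.mk (τ.along p) : SL2C ⧸ P)

end BruhatCocycle

end Cocycles

end Ptolemy

end

/-!
A decorated boundary-unipotent representation and a Bruhat cocycle are two descriptions of one
object: a flat `SL(2, ℂ)`-bundle over `M` with a parallel reduction to `P` along the boundary. The
correspondence is the relation `IsCompatible`, which is invariant under both equivalences; it is
bijective for the following reasons.

*Every cocycle is compatible with some decorated representation*
(`BruhatCocycle.exists_decoratedRep`). On a single truncated simplex a cocycle is a coboundary; let
`potential` be a primitive. Its discrepancy across a glued face is the same at all corners of that
face, and gives a `transition` element. Gluing the copies `{g} × simplex`, `g ∈ SL(2, ℂ)`, by means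
of these elements yields the space `FlatBundle` over `M`. It is a covering of `M` with the discrete
group `SL(2, ℂ)` acting simply transitively on the fibers (`FlatBundle.isQuotientCoveringMap`), so
that Mathlib's monodromy supplies the holonomy representation. To find a trivialization near a point
`m` of `M`, one takes a small `Star` of `m` and assigns to each preimage of `m` a corner of its
simplex, lying on all the faces that contain the preimage, compatibly with the gluing
(`exists_corner_section`); the potential at that corner is the coordinate of the fiber. If `m` lies
on a long edge, such a choice of corners is an orientation of this edge, and exists because no edge
is glued to itself with reversed orientation. Any other point has at most two preimages, on faces
glued to each other, and a corner chosen at one of them can be transported to the other. Since short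
edges are labeled by elements of `P`, the coset of the potential near an ideal vertex is well
defined, which gives the decoration (`FlatBundle.coset`).

*Every decorated representation is compatible with some cocycle* (`DecoratedRep.exists_cocycle`).
After the choice of paths from the base point to the vertices, the representation extends to all
paths between vertices, and each vertex gets a coset in `SL(2, ℂ) ⧸ P`. A choice `g` of
representatives of these cosets gives the cocycle `g(e₀)⁻¹ ρ(e) g(e₁)`, whose short labels are in `P`
because the two ends of a short edge give the same ideal point. Each vertex of the decomposition is
the end of exactly one long edge, and the two ends of this edge are distinct, again because no edge
is reversed. So the representatives can be chosen for each long edge separately, and the Bruhat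
decomposition provides a choice that makes the long label diagonal or counter-diagonal
(`exists_bruhat_representatives`).

*Each of the two classes determines the other* (`IsCompatible.rep_equiv`,
`IsCompatible.cocycle_equiv`). Every homotopy class of paths between vertices contains an edge path
(`IdealTriangulation.exists_edgePath`). This follows from the fact that a path in a star is homotopic
to one through its center, which is proved by the straight contraction of the star. Hence a
compatible cocycle and representation determine each other's values on all such paths, up to the
equivalences in question; an element of `SL(2, ℂ)` that relates two representatives of a coset is in
`P`.
-/

noncomputable section

namespace Ptolemy

open Topology Set

/-! ### Corners and the gluing of truncated simplices -/

theorem Corner.ext_iff' {c d : Corner} : c = d ↔ c.near = d.near ∧ c.dir = d.dir := by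
  cases c; cases d; simp

/-- The image of a vertex of the truncated simplex under a permutation of the coordinates. -/
def Corner.map (σ : Equiv.Perm (Fin 4)) (c : Corner) : Corner :=
  ⟨σ c.near, σ c.dir, σ.injective.ne c.ne⟩

/-- The other endpoint of the long edge through a vertex of the truncated simplex. -/
def Corner.swap (c : Corner) : Corner := ⟨c.dir, c.near, c.ne.symm⟩

@[simp] theorem Corner.swap_swap (c : Corner) : c.swap.swap = c := rfl

@[simp] theorem Corner.point_near (c : Corner) : c.point.1 c.near = 2 / 3 := by
  simp [Corner.point]

@[simp] theorem Corner.point_dir (c : Corner) : c.point.1 c.dir = 1 / 3 := by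
  simp [Corner.point, c.ne.symm]

theorem Corner.point_eq_zero_iff (c : Corner) (a : Fin 4) :
    c.point.1 a = 0 ↔ a ≠ c.near ∧ a ≠ c.dir := by
  simp only [Corner.point]
  split_ifs with h1 h2 <;> simp_all

theorem Corner.point_injective : Function.Injective Corner.point := by
  intro c d h
  have h1 : d.point.1 c.near = 2 / 3 := by rw [← h]; simp
  have h2 : d.point.1 c.dir = 1 / 3 := by rw [← h]; simp
  rw [Corner.ext_iff']
  simp only [Corner.point] at h1 h2
  split_ifs at h1 h2 <;> first | (norm_num at h1; done) | (norm_num at h2; done) | simp_all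

theorem Corner.map_point (σ : Equiv.Perm (Fin 4)) (c : Corner) (a : Fin 4) :
    (c.map σ).point.1 (σ a) = c.point.1 a := by
  simp [Corner.point, Corner.map]

/-- A permutation of the coordinates of a point of the truncated simplex: the coordinate `σ a` of
the new point is the coordinate `a` of the old one. -/
def permPoint (σ : Equiv.Perm (Fin 4)) (x : TruncatedSimplex) : TruncatedSimplex :=
  ⟨fun a => x.1 (σ.symm a), ⟨fun a => x.2.1.1 _, by
    rw [← x.2.1.2]; exact Equiv.sum_comp σ.symm x.1⟩, fun a => x.2.2 _⟩

@[simp] theorem permPoint_apply (σ : Equiv.Perm (Fin 4)) (x : TruncatedSimplex) (a : Fin 4) :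
    (permPoint σ x).1 (σ a) = x.1 a := by
  simp [permPoint]

theorem eq_permPoint_iff {σ : Equiv.Perm (Fin 4)} {x y : TruncatedSimplex} :
    y = permPoint σ x ↔ ∀ a, y.1 (σ a) = x.1 a := by
  constructor
  · rintro rfl a; simp
  · intro h
    apply Subtype.ext
    funext a
    obtain ⟨b, rfl⟩ := σ.surjective a
    rw [h, permPoint_apply]

theorem Corner.permPoint_point (σ : Equiv.Perm (Fin 4)) (c : Corner) :
    permPoint σ c.point = (c.map σ).point :=
  (eq_permPoint_iff.2 (c.map_point σ)).symm

theorem permPoint_inv_permPoint (σ : Equiv.Perm (Fin 4)) (x : TruncatedSimplex) :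
    permPoint σ⁻¹ (permPoint σ x) = x := by
  symm
  rw [eq_permPoint_iff]
  intro a
  obtain ⟨b, rfl⟩ := σ.surjective a
  simp

theorem Corner.map_inv_map (σ : Equiv.Perm (Fin 4)) (c : Corner) :
    (c.map σ).map σ⁻¹ = c := by
  simp [Corner.map]

/-- Every point of the truncated simplex has two nonzero coordinates, since a single one would
be equal to `1`. -/
theorem exists_corner_in_support (x : TruncatedSimplex) :
    ∃ c : Corner, x.1 c.near ≠ 0 ∧ x.1 c.dir ≠ 0 := by
  by_contra! h
  have hs := x.2.1.2
  have h0 := x.2.2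
  have key : ∀ i j, i ≠ j → x.1 i ≠ 0 → x.1 j = 0 := fun i j hij => h ⟨i, j, hij⟩
  obtain ⟨i, hi⟩ : ∃ i, x.1 i ≠ 0 := by
    by_contra! h'
    simp [h'] at hs
  rw [Finset.sum_eq_single i (fun j _ hj => key i j hj.symm hi) (by simp)] at hs
  have := h0 i
  rw [hs] at this
  norm_num at this

namespace FacePairing

variable {n : ℕ} (F : FacePairing n)

/-- The point glued to `p` along the face `f`. -/
def glue (f : Fin 4) (p : Fin n × TruncatedSimplex) : Fin n × TruncatedSimplex :=
  (F.adj p.1 f, permPoint (F.perm p.1 f) p.2)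

theorem pointGlued_iff {p q : Fin n × TruncatedSimplex} :
    F.PointGlued p q ↔ ∃ f : Fin 4, p.2.1 f = 0 ∧ q = F.glue f p := by
  unfold PointGlued
  refine exists_congr fun f => and_congr_right fun _ => ?_
  rw [← eq_permPoint_iff, Prod.ext_iff]
  rfl

theorem glue_glue (f : Fin 4) (p : Fin n × TruncatedSimplex) :
    F.glue (F.perm p.1 f f) (F.glue f p) = p := by
  refine Prod.ext (F.adj_adj _ _) ?_
  change permPoint (F.perm (F.adj p.1 f) (F.perm p.1 f f)) (permPoint (F.perm p.1 f) p.2) = p.2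
  rw [F.perm_perm, permPoint_inv_permPoint]

theorem glue_apply_perm (f : Fin 4) (p : Fin n × TruncatedSimplex) (a : Fin 4) :
    (F.glue f p).2.1 (F.perm p.1 f a) = p.2.1 a :=
  permPoint_apply _ _ _

variable {F} in
theorem PointGlued.symm {p q : Fin n × TruncatedSimplex} (h : F.PointGlued p q) :
    F.PointGlued q p := by
  rw [pointGlued_iff] at h ⊢
  obtain ⟨f, hf, rfl⟩ := h
  exact ⟨F.perm p.1 f f, by rw [glue_apply_perm, hf], (F.glue_glue f p).symm⟩

variable {F} in
theorem PointGlued.range_eq {p q : Fin n × TruncatedSimplex} (h : F.PointGlued p q) :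
    range q.2.1 = range p.2.1 := by
  obtain ⟨f, -, rfl⟩ := F.pointGlued_iff.1 h
  rw [← (F.perm p.1 f).surjective.range_comp]
  congr 1
  funext a
  exact F.glue_apply_perm f p a

variable {F} in
/-- A property of points that is preserved by each gluing along a face is preserved by the
equivalence relation that these gluings generate. -/
theorem eqvGen_pointGlued_induction {C : Fin n × TruncatedSimplex → Prop}
    (h : ∀ p f, p.2.1 f = 0 → C p → C (F.glue f p)) {p q : Fin n × TruncatedSimplex}
    (hpq : Relation.EqvGen F.PointGlued p q) (hp : C p) : C q := by
  have h' : ∀ p q, F.PointGlued p q → C p → C q := by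
    intro p q hpq hp
    obtain ⟨f, hf, rfl⟩ := F.pointGlued_iff.1 hpq
    exact h p f hf hp
  suffices C p ↔ C q from this.1 hp
  clear hp
  induction hpq with
  | rel p q hpq => exact ⟨h' p q hpq, h' q p hpq.symm⟩
  | refl => rfl
  | symm _ _ _ ih => exact ih.symm
  | trans _ _ _ _ _ ih1 ih2 => exact ih1.trans ih2

end FacePairing

namespace IdealTriangulation

variable {M : Type*} [TopologicalSpace M] (T : IdealTriangulation M)

theorem cell_glue (f : Fin 4) (p : Fin T.n × TruncatedSimplex) (hf : p.2.1 f = 0) :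
    T.cell (T.pairing.glue f p).1 (T.pairing.glue f p).2 = T.cell p.1 p.2 :=
  ((T.cell_eq_cell_iff p _).2 (.rel _ _ (T.pairing.pointGlued_iff.2 ⟨f, hf, rfl⟩))).symm

variable {T} in
theorem induction_of_cell_eq {C : Fin T.n × TruncatedSimplex → Prop}
    (h : ∀ p f, p.2.1 f = 0 → C p → C (T.pairing.glue f p)) {p q : Fin T.n × TruncatedSimplex}
    (hpq : T.cell p.1 p.2 = T.cell q.1 q.2) (hp : C p) : C q :=
  FacePairing.eqvGen_pointGlued_induction h ((T.cell_eq_cell_iff p q).1 hpq) hp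

variable {T} in
theorem range_eq_of_cell_eq {p q : Fin T.n × TruncatedSimplex}
    (hpq : T.cell p.1 p.2 = T.cell q.1 q.2) : range p.2.1 = range q.2.1 := by
  refine T.induction_of_cell_eq (C := fun r => range p.2.1 = range r.2.1) ?_ hpq rfl
  intro r f hf h
  rw [h, (T.pairing.pointGlued_iff.2 ⟨f, hf, rfl⟩ : T.pairing.PointGlued r _).range_eq]

theorem cell_surjective (m : M) : ∃ p : Fin T.n × TruncatedSimplex, T.cell p.1 p.2 = m :=
  T.isQuotientMap_cell.surjective m

/-! ### Stars of points -/

/-- A star of the point `m`: a saturated open set `carrier` of points of the truncated simplices,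
each of which is assigned a preimage `center` of `m` in the same simplex.  The assignment is
locally constant and compatible with the gluing of the faces. -/
structure Star (m : M) where
  carrier : Set (Fin T.n × TruncatedSimplex)
  isOpen : IsOpen carrier
  center : Fin T.n × TruncatedSimplex → TruncatedSimplex
  cell_center : ∀ p ∈ carrier, T.cell p.1 (center p) = m
  eventually_center : ∀ p ∈ carrier, ∀ᶠ q in 𝓝 p, q.1 = p.1 ∧ center q = center p
  center_face : ∀ p ∈ carrier, ∀ f, p.2.1 f = 0 → (center p).1 f = 0
  glue_mem : ∀ p ∈ carrier, ∀ f, p.2.1 f = 0 → T.pairing.glue f p ∈ carrier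
  center_glue : ∀ p ∈ carrier, ∀ f, p.2.1 f = 0 →
    center (T.pairing.glue f p) = permPoint (T.pairing.perm p.1 f) (center p)
  mem : ∀ p, T.cell p.1 p.2 = m → p ∈ carrier
  center_eq : ∀ p, T.cell p.1 p.2 = m → center p = p.2

/-- There is a scale separating the coordinates of the preimages of a point. -/
theorem exists_separation (m : M) : ∃ ε : ℝ, 0 < ε ∧
    (∀ t x y, T.cell t x = m → T.cell t y = m → (∀ a, |x.1 a - y.1 a| < 2 * ε) → x = y) ∧
    ∀ t x, T.cell t x = m → ∀ a, x.1 a < ε → x.1 a = 0 := by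
  obtain ⟨p, hp⟩ := T.cell_surjective m
  have h1 : ∃ ε : ℝ, 0 < ε ∧ ∀ a, p.2.1 a < ε → p.2.1 a = 0 := by
    have h : ∀ᶠ ε : ℝ in 𝓝[>] 0, ∀ a, p.2.1 a < ε → p.2.1 a = 0 := by
      rw [Filter.eventually_all]
      intro a
      rcases eq_or_lt_of_le (p.2.2.1.1 a) with h | h
      · exact Filter.Eventually.of_forall fun _ _ => h.symm
      · filter_upwards [Ioo_mem_nhdsGT h] with ε hε h'
        exact absurd h' (not_lt.2 hε.2.le)
    obtain ⟨ε, h2, h3⟩ := (h.and self_mem_nhdsWithin).exists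
    exact ⟨ε, h3, h2⟩
  have h2 : ∃ ε : ℝ, 0 < ε ∧ ∀ a b, |p.2.1 a - p.2.1 b| < 2 * ε → p.2.1 a = p.2.1 b := by
    have h : ∀ᶠ ε : ℝ in 𝓝[>] 0, ∀ a b, |p.2.1 a - p.2.1 b| < 2 * ε → p.2.1 a = p.2.1 b := by
      rw [Filter.eventually_all]
      intro a
      rw [Filter.eventually_all]
      intro b
      by_cases h : p.2.1 a = p.2.1 b
      · exact Filter.Eventually.of_forall fun _ _ => h
      · have h' : 0 < |p.2.1 a - p.2.1 b| / 2 := by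
          have := abs_pos.2 (sub_ne_zero.2 h)
          positivity
        filter_upwards [Ioo_mem_nhdsGT h'] with ε hε h''
        have := hε.2
        linarith
    obtain ⟨ε, h2, h3⟩ := (h.and self_mem_nhdsWithin).exists
    exact ⟨ε, h3, h2⟩
  obtain ⟨ε, hε, h1⟩ := h1
  obtain ⟨δ, hδ, h2⟩ := h2
  -- The preimages of `m` all have the same coordinates, up to order.
  have hr : ∀ t x, T.cell t x = m → ∀ a, ∃ b, p.2.1 b = x.1 a := by
    intro t x hx a
    have : x.1 a ∈ range p.2.1 := by
      rw [T.range_eq_of_cell_eq (p := p) (q := (t, x)) (hp.trans hx.symm)]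
      exact mem_range_self a
    exact this
  refine ⟨min ε δ, lt_min hε hδ, ?_, ?_⟩
  · intro t x y hx hy hxy
    apply Subtype.ext
    funext a
    obtain ⟨b, hb⟩ := hr t x hx a
    obtain ⟨c, hc⟩ := hr t y hy a
    rw [← hb, ← hc]
    apply h2
    rw [hb, hc]
    have := min_le_right ε δ
    linarith [hxy a]
  · intro t x hx a ha
    obtain ⟨b, hb⟩ := hr t x hx a
    rw [← hb] at ha ⊢
    exact h1 b (ha.trans_le (min_le_left _ _))

/-- The points close to a preimage of `m`, at the scale given by `exists_separation`, form a star of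
`m`. -/
theorem nonempty_star (m : M) : Nonempty (T.Star m) := by
  classical
  obtain ⟨ε, hε, hsep, hzero⟩ := T.exists_separation m
  let near : Fin T.n × TruncatedSimplex → TruncatedSimplex → Prop := fun p x =>
    T.cell p.1 x = m ∧ ∀ a, |p.2.1 a - x.1 a| < ε
  have huniq : ∀ t (y z x x' : TruncatedSimplex), near (t, y) x → near (t, z) x' →
      y = z → x = x' := by
    rintro t y z x x' h h' rfl
    refine hsep t x x' h.1 h'.1 fun a => ?_
    have h1 := abs_lt.1 (h.2 a)
    have h2 := abs_lt.1 (h'.2 a)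
    dsimp only at h1 h2
    rw [abs_lt]
    constructor <;> linarith
  have hopen : ∀ t x, IsOpen {p | p.1 = t ∧ near p x} := by
    intro t x
    have h0 : {p | p.1 = t ∧ near p x} =
        {p | p.1 = t ∧ T.cell t x = m} ∩ ⋂ a, {p : Fin T.n × TruncatedSimplex |
          |p.2.1 a - x.1 a| < ε} := by
      ext p
      simp only [near, mem_ofPred_eq, mem_inter_iff, mem_iInter, and_assoc]
      constructor
      · rintro ⟨rfl, h⟩; exact ⟨rfl, h⟩
      · rintro ⟨rfl, h⟩; exact ⟨rfl, h⟩
    rw [h0]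
    refine IsOpen.inter ?_ (isOpen_iInter_of_finite fun a => ?_)
    · exact (isOpen_discrete {s : Fin T.n | s = t ∧ T.cell t x = m}).preimage continuous_fst
    · refine isOpen_lt ?_ continuous_const
      have : Continuous fun p : Fin T.n × TruncatedSimplex => p.2.1 a :=
        (continuous_apply a).comp (continuous_subtype_val.comp continuous_snd)
      fun_prop
  let κ : Fin T.n × TruncatedSimplex → TruncatedSimplex := fun p =>
    if h : ∃ x, near p x then h.choose else p.2
  have hκ : ∀ p x, near p x → κ p = x := by
    intro p x h
    have h' : ∃ x, near p x := ⟨x, h⟩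
    have : κ p = h'.choose := dif_pos h'
    rw [this]
    exact huniq p.1 p.2 p.2 _ _ h'.choose_spec h rfl
  have hface : ∀ p x, near p x → ∀ f, p.2.1 f = 0 → x.1 f = 0 := by
    intro p x h f hf
    refine hzero p.1 x h.1 f ?_
    have := abs_lt.1 (h.2 f)
    linarith
  have hglue : ∀ p x, near p x → ∀ f, p.2.1 f = 0 →
      near (T.pairing.glue f p) (permPoint (T.pairing.perm p.1 f) x) := by
    intro p x h f hf
    refine ⟨(T.cell_glue f (p.1, x) (hface p x h f hf)).trans h.1, fun a => ?_⟩
    obtain ⟨b, rfl⟩ := (T.pairing.perm p.1 f).surjective a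
    rw [T.pairing.glue_apply_perm, permPoint_apply]
    exact h.2 b
  refine ⟨{
    carrier := {p | ∃ x, near p x}
    isOpen := ?_
    center := κ
    cell_center := ?_
    eventually_center := ?_
    center_face := ?_
    glue_mem := ?_
    center_glue := ?_
    mem := ?_
    center_eq := ?_ }⟩
  · rw [isOpen_iff_mem_nhds]
    rintro p ⟨x, hx⟩
    filter_upwards [(hopen p.1 x).mem_nhds ⟨rfl, hx⟩] with q hq
    exact ⟨x, hq.2⟩
  · rintro p ⟨x, hx⟩
    rw [hκ p x hx, hx.1]
  · rintro p ⟨x, hx⟩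
    filter_upwards [(hopen p.1 x).mem_nhds ⟨rfl, hx⟩] with q hq
    exact ⟨hq.1, by rw [hκ p x hx, hκ q x hq.2]⟩
  · rintro p ⟨x, hx⟩ f hf
    rw [hκ p x hx]
    exact hface p x hx f hf
  · rintro p ⟨x, hx⟩ f hf
    exact ⟨_, hglue p x hx f hf⟩
  · rintro p ⟨x, hx⟩ f hf
    rw [hκ p x hx, hκ _ _ (hglue p x hx f hf)]
  · intro p hp
    exact ⟨p.2, hp, fun a => by simpa using hε⟩
  · intro p hp
    exact hκ p p.2 ⟨hp, fun a => by simpa using hε⟩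

namespace Star

variable {T} {m : M} (S : T.Star m)

theorem mem_of_cell_eq {p q : Fin T.n × TruncatedSimplex} (h : T.cell p.1 p.2 = T.cell q.1 q.2)
    (hp : p ∈ S.carrier) : q ∈ S.carrier :=
  T.induction_of_cell_eq (fun p f hf hp => S.glue_mem p hp f hf) h hp

/-- The star as an open subset of `M`. -/
def nhd : Set M := {m' | ∃ p ∈ S.carrier, T.cell p.1 p.2 = m'}

theorem preimage_nhd :
    (fun p : Fin T.n × TruncatedSimplex => T.cell p.1 p.2) ⁻¹' S.nhd = S.carrier := by
  ext p
  exact ⟨fun ⟨q, hq, h⟩ => S.mem_of_cell_eq h hq, fun hp => ⟨p, hp, rfl⟩⟩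

theorem isOpen_nhd : IsOpen S.nhd := by
  rw [← T.isQuotientMap_cell.isOpen_preimage, S.preimage_nhd]
  exact S.isOpen

theorem mem_nhd : m ∈ S.nhd := by
  obtain ⟨p, hp⟩ := T.cell_surjective m
  exact ⟨p, S.mem p hp, hp⟩

end Star

end IdealTriangulation

/-! ### Selecting long edges along the preimages of a point -/

/-- The long edge of the `t`-th simplex starting at a given corner. -/
def longEdge {n : ℕ} (t : Fin n) (c : Corner) : OrientedEdge n := .long t c.near c.dir c.ne

namespace IdealTriangulation

variable {M : Type*} [TopologicalSpace M] {T : IdealTriangulation M}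

theorem edgeGlued_longEdge (t : Fin T.n) (c : Corner) (f : Fin 4) (h : f ≠ c.near)
    (h' : f ≠ c.dir) : T.pairing.EdgeGlued (longEdge t c)
      (longEdge (T.pairing.adj t f) (c.map (T.pairing.perm t f))) :=
  .long t f c.near c.dir h h' c.ne

/-- A property of the corners of the simplices that is preserved by the gluing along faces only
depends on the position of the corners in `M`. -/
theorem corner_induction {C : Fin T.n → Corner → Prop}
    (h : ∀ t c f, f ≠ c.near → f ≠ c.dir → C t c →
      C (T.pairing.adj t f) (c.map (T.pairing.perm t f)))
    {t t' : Fin T.n} {c c' : Corner} (hc : T.cell t c.point = T.cell t' c'.point) (htc : C t c) :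
    C t' c' := by
  have := T.induction_of_cell_eq (p := (t, c.point)) (q := (t', c'.point))
    (C := fun p => ∃ d : Corner, p.2 = d.point ∧ C p.1 d) ?_ hc ⟨c, rfl, htc⟩
  · obtain ⟨d, hd, hC⟩ := this
    rwa [Corner.point_injective hd]
  · rintro ⟨s, _⟩ f hf ⟨d, rfl, hd⟩
    obtain ⟨h1, h2⟩ := (d.point_eq_zero_iff f).1 hf
    exact ⟨d.map (T.pairing.perm s f), d.permPoint_point _, h s d f h1 h2 hd⟩

theorem eqvGen_longEdge {t t' : Fin T.n} {c c' : Corner}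
    (hc : T.cell t c.point = T.cell t' c'.point) :
    Relation.EqvGen T.pairing.EdgeGlued (longEdge t c) (longEdge t' c') := by
  refine T.corner_induction
    (C := fun s d => Relation.EqvGen T.pairing.EdgeGlued (longEdge t c) (longEdge s d)) ?_ hc
    (.refl _)
  intro s d f h1 h2 h
  exact h.trans _ _ _ (.rel _ _ (edgeGlued_longEdge s d f h1 h2))

/-- The two ends of a long edge are distinct in `M`. -/
theorem cell_swap_ne (t : Fin T.n) (c : Corner) : T.cell t c.point ≠ T.cell t c.swap.point :=
  fun h => T.no_reversed_edge _ (eqvGen_longEdge h)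

/-- `CornerGlued` transports a corner of a simplex along a gluing that fixes the support of a
given point. -/
def CornerGlued (T : IdealTriangulation M) (a b : (Fin T.n × TruncatedSimplex) × Corner) : Prop :=
  ∃ f, a.1.2.1 f = 0 ∧ b = (T.pairing.glue f a.1, a.2.map (T.pairing.perm a.1.1 f))

theorem CornerGlued.support {a b : (Fin T.n × TruncatedSimplex) × Corner}
    (h : Relation.ReflTransGen T.CornerGlued a b)
    (ha : a.1.2.1 a.2.near ≠ 0 ∧ a.1.2.1 a.2.dir ≠ 0) :
    (b.1.2.1 b.2.near ≠ 0 ∧ b.1.2.1 b.2.dir ≠ 0) ∧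
      Relation.EqvGen T.pairing.EdgeGlued (longEdge a.1.1 a.2) (longEdge b.1.1 b.2) := by
  induction h with
  | refl => exact ⟨ha, .refl _⟩
  | tail _ hbc ih =>
    rename_i b c _
    obtain ⟨f, hf, rfl⟩ := hbc
    obtain ⟨⟨h1, h2⟩, h3⟩ := ih
    refine ⟨⟨?_, ?_⟩, h3.trans _ _ _ (.rel _ _ (edgeGlued_longEdge _ _ f ?_ ?_))⟩
    · exact (T.pairing.glue_apply_perm f b.1 b.2.near).trans_ne h1
    · exact (T.pairing.glue_apply_perm f b.1 b.2.dir).trans_ne h2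
    · rintro rfl; exact h1 hf
    · rintro rfl; exact h2 hf

/-- Transporting a corner in the support of a point around the preimages of the image of that point
in `M` does not change it: if the support is an edge, because no edge is glued to itself with
reversed orientation; otherwise, because there are at most two preimages. -/
theorem CornerGlued.unique {a : (Fin T.n × TruncatedSimplex) × Corner}
    (ha : a.1.2.1 a.2.near ≠ 0 ∧ a.1.2.1 a.2.dir ≠ 0) {q : Fin T.n × TruncatedSimplex}
    {c c' : Corner} (h : Relation.ReflTransGen T.CornerGlued a (q, c))
    (h' : Relation.ReflTransGen T.CornerGlued a (q, c')) : c = c' := by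
  by_cases hz : ∃ f f', f ≠ f' ∧ a.1.2.1 f = 0 ∧ a.1.2.1 f' = 0
  · have hz' : ∀ b, Relation.ReflTransGen T.CornerGlued a b →
        ∃ f f', f ≠ f' ∧ b.1.2.1 f = 0 ∧ b.1.2.1 f' = 0 := by
      intro b hb
      induction hb with
      | refl => exact hz
      | tail _ hbc ih =>
        rename_i b c _
        obtain ⟨g, hg, rfl⟩ := hbc
        obtain ⟨f, f', hne, hf, hf'⟩ := ih
        exact ⟨_, _, (T.pairing.perm b.1.1 g).injective.ne hne,
          (T.pairing.glue_apply_perm g b.1 f).trans hf,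
          (T.pairing.glue_apply_perm g b.1 f').trans hf'⟩
    obtain ⟨f, f', hne, hf, hf'⟩ := hz' _ h
    dsimp only at hf hf'
    obtain ⟨⟨h1, h2⟩, h3⟩ := CornerGlued.support h ha
    obtain ⟨⟨h1', h2'⟩, h3'⟩ := CornerGlued.support h' ha
    dsimp only at h1 h2 h1' h2' h3 h3'
    have hc : c' = c ∨ c' = c.swap := by
      have e1 : c.near ≠ f := by rintro rfl; exact h1 hf
      have e2 : c.near ≠ f' := by rintro rfl; exact h1 hf'
      have e3 : c.dir ≠ f := by rintro rfl; exact h2 hf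
      have e4 : c.dir ≠ f' := by rintro rfl; exact h2 hf'
      have e5 : c'.near ≠ f := by rintro rfl; exact h1' hf
      have e6 : c'.near ≠ f' := by rintro rfl; exact h1' hf'
      have e7 : c'.dir ≠ f := by rintro rfl; exact h2' hf
      have e8 : c'.dir ≠ f' := by rintro rfl; exact h2' hf'
      have e9 := c.ne
      have e10 := c'.ne
      simp only [Corner.ext_iff', Corner.swap]
      omega
    rcases hc with hc | rfl
    · exact hc.symm
    · exact (T.no_reversed_edge _ ((h3.symm _ _).trans _ _ _ h3')).elim
  · have hz1 : ∀ f f', a.1.2.1 f = 0 → a.1.2.1 f' = 0 → f = f' := by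
      intro f f' h1 h2
      by_contra hne
      exact hz ⟨f, f', hne, h1, h2⟩
    have key : ∀ b, Relation.ReflTransGen T.CornerGlued a b →
        b = a ∨ ∃ f, a.1.2.1 f = 0 ∧
          b = (T.pairing.glue f a.1, a.2.map (T.pairing.perm a.1.1 f)) := by
      intro b hb
      induction hb with
      | refl => exact .inl rfl
      | tail _ hbc ih =>
        obtain ⟨g, hg, rfl⟩ := hbc
        rcases ih with rfl | ⟨f, hf, rfl⟩
        · exact .inr ⟨g, hg, rfl⟩
        · left
          -- the face `g` along which one goes on is the one along which one came
          have hgf : g = T.pairing.perm a.1.1 f f := by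
            obtain ⟨k, rfl⟩ := (T.pairing.perm a.1.1 f).surjective g
            have hk : a.1.2.1 k = 0 := (T.pairing.glue_apply_perm f a.1 k).symm.trans hg
            rw [hz1 k f hk hf]
          subst hgf
          refine Prod.ext (T.pairing.glue_glue f a.1) ?_
          change (a.2.map (T.pairing.perm a.1.1 f)).map
            (T.pairing.perm (T.pairing.adj a.1.1 f) (T.pairing.perm a.1.1 f f)) = a.2
          rw [T.pairing.perm_perm, Corner.map_inv_map]
    have hfix : ∀ f, a.1.2.1 f = 0 → a.1 ≠ T.pairing.glue f a.1 := by
      intro f hf h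
      have h1 : T.pairing.adj a.1.1 f = a.1.1 := (congrArg Prod.fst h).symm
      have h2 : T.pairing.perm a.1.1 f f = f := by
        refine hz1 _ _ ?_ hf
        have h3 := T.pairing.glue_apply_perm f a.1 f
        rw [← h] at h3
        exact h3.trans hf
      exact T.pairing.no_fixed_face a.1.1 f (Prod.ext h1 h2)
    rcases key _ h with h1 | ⟨f, hf, h1⟩ <;> rcases key _ h' with h2 | ⟨f', hf', h2⟩
    · exact congrArg Prod.snd (h1.trans h2.symm)
    · exact (hfix f' hf' ((congrArg Prod.fst h1).symm.trans (congrArg Prod.fst h2))).elim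
    · exact (hfix f hf ((congrArg Prod.fst h2).symm.trans (congrArg Prod.fst h1))).elim
    · rw [hz1 f f' hf hf'] at h1
      exact congrArg Prod.snd (h1.trans h2.symm)

/-- The preimages of a point of `M` can be assigned corners of the respective simplices, lying on
all the faces that contain the preimage, in a way compatible with the gluing. -/
theorem exists_corner_section (m : M) : ∃ c : Fin T.n × TruncatedSimplex → Corner,
    ∀ p, T.cell p.1 p.2 = m → ∀ f, p.2.1 f = 0 →
      (f ≠ (c p).near ∧ f ≠ (c p).dir) ∧
        c (T.pairing.glue f p) = (c p).map (T.pairing.perm p.1 f) := by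
  classical
  obtain ⟨p₀, hp₀⟩ := T.cell_surjective m
  obtain ⟨c₀, hc₀⟩ := exists_corner_in_support p₀.2
  have hex : ∀ p, T.cell p.1 p.2 = m →
      ∃ c, Relation.ReflTransGen T.CornerGlued (p₀, c₀) (p, c) := by
    intro p hp
    refine T.induction_of_cell_eq
      (C := fun p => ∃ c, Relation.ReflTransGen T.CornerGlued (p₀, c₀) (p, c)) ?_
      (hp₀.trans hp.symm) ⟨c₀, .refl⟩
    rintro q f hf ⟨c, hc⟩
    exact ⟨_, hc.tail ⟨f, hf, rfl⟩⟩
  refine ⟨fun p => if h : T.cell p.1 p.2 = m then (hex p h).choose else c₀, fun p hp f hf => ?_⟩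
  have hp' : T.cell (T.pairing.glue f p).1 (T.pairing.glue f p).2 = m :=
    (T.cell_glue f p hf).trans hp
  dsimp only
  rw [dif_pos hp, dif_pos hp']
  have h1 := (hex p hp).choose_spec
  have h2 := (hex _ hp').choose_spec
  have h3 := (CornerGlued.support h1 hc₀).1
  refine ⟨⟨?_, ?_⟩, CornerGlued.unique hc₀ h2 (h1.tail ⟨f, hf, rfl⟩)⟩
  · intro h; rw [h] at hf; exact h3.1 hf
  · intro h; rw [h] at hf; exact h3.2 hf

end IdealTriangulation

/-! ### Potentials of a cocycle on one simplex -/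

namespace BruhatCocycle

variable {M : Type*} [TopologicalSpace M] {T : IdealTriangulation M} (τ : BruhatCocycle T)

open Classical in
/-- The label of a short edge, extended by `1` to degenerate edges. -/
def shortLabel (t : Fin T.n) (k i j : Fin 4) : SL2C :=
  if h : k ≠ i ∧ k ≠ j ∧ i ≠ j then τ.label (.short t k i j h.1 h.2.1 h.2.2) else 1

open Classical in
/-- The label of a long edge, extended by `1` to degenerate edges. -/
def longLabel (t : Fin T.n) (i j : Fin 4) : SL2C :=
  if h : i ≠ j then τ.label (.long t i j h) else 1

variable {t : Fin T.n} {i j k l : Fin 4}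

theorem shortLabel_of_ne (hki : k ≠ i) (hkj : k ≠ j) (hij : i ≠ j) :
    τ.shortLabel t k i j = τ.label (.short t k i j hki hkj hij) :=
  dif_pos ⟨hki, hkj, hij⟩

theorem longLabel_of_ne (hij : i ≠ j) : τ.longLabel t i j = τ.label (.long t i j hij) :=
  dif_pos hij

@[simp] theorem shortLabel_self : τ.shortLabel t k i i = 1 :=
  dif_neg fun h => h.2.2 rfl

theorem shortLabel_symm (hki : k ≠ i) (hkj : k ≠ j) :
    τ.shortLabel t k j i = (τ.shortLabel t k i j)⁻¹ := by
  by_cases hij : i = j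
  · subst hij; simp
  · rw [τ.shortLabel_of_ne hki hkj hij, τ.shortLabel_of_ne hkj hki (Ne.symm hij),
      ← τ.label_reverse]
    rfl

theorem longLabel_symm (hij : i ≠ j) : τ.longLabel t j i = (τ.longLabel t i j)⁻¹ := by
  rw [τ.longLabel_of_ne hij, τ.longLabel_of_ne hij.symm, ← τ.label_reverse]
  rfl

theorem shortLabel_trans (hki : k ≠ i) (hkj : k ≠ j) (hkl : k ≠ l) :
    τ.shortLabel t k i j * τ.shortLabel t k j l = τ.shortLabel t k i l := by
  by_cases hij : i = j
  · subst hij; simp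
  by_cases hjl : j = l
  · subst hjl; simp
  by_cases hil : i = l
  · subst hil
    rw [τ.shortLabel_symm hki hkj]
    simp
  · have h := τ.triangle t k i j l hki hkj hkl hij hjl (Ne.symm hil)
    rw [← τ.shortLabel_of_ne, ← τ.shortLabel_of_ne, ← τ.shortLabel_of_ne,
      τ.shortLabel_symm hki hkl] at h
    exact mul_inv_eq_one.1 h

theorem longLabel_trans (hij : i ≠ j) (hjk : j ≠ k) (hki : k ≠ i) :
    τ.longLabel t i j * τ.shortLabel t j i k * τ.longLabel t j k =
      τ.shortLabel t i j k * τ.longLabel t i k * τ.shortLabel t k i j := by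
  have h := τ.hexagon t i j k hij hjk hki
  rw [← τ.longLabel_of_ne, ← τ.longLabel_of_ne, ← τ.longLabel_of_ne, ← τ.shortLabel_of_ne,
    ← τ.shortLabel_of_ne, ← τ.shortLabel_of_ne, τ.shortLabel_symm hki hjk.symm,
    τ.longLabel_symm hki.symm, τ.shortLabel_symm hij hki.symm] at h
  rw [← mul_inv_eq_one]
  simpa only [mul_assoc, mul_inv_rev] using h

/-- On a single simplex, a cocycle is a coboundary. -/
theorem exists_potential (t : Fin T.n) : ∃ ψ : Corner → SL2C,
    ∀ e : OrientedEdge T.n, e.tet = t → ψ e.target = ψ e.source * τ.label e := by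
  -- the product of the labels along a path from the corner of `0` pointing to `1`
  let ψ : Fin 4 → Fin 4 → SL2C := fun k i => if k = 0 then τ.shortLabel t 0 1 i else
    τ.shortLabel t 0 1 k * τ.longLabel t 0 k * τ.shortLabel t k 0 i
  have h0 : ∀ i, ψ 0 i = τ.shortLabel t 0 1 i := fun i => if_pos rfl
  have h1 : ∀ k i, k ≠ 0 → ψ k i =
    τ.shortLabel t 0 1 k * τ.longLabel t 0 k * τ.shortLabel t k 0 i := fun k i h => if_neg h
  have h01 : (0 : Fin 4) ≠ 1 := by decide
  refine ⟨fun c => ψ c.near c.dir, ?_⟩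
  rintro (⟨s, i, j, hij⟩ | ⟨s, k, i, j, hki, hkj, hij⟩) hs
  · obtain rfl : s = t := hs
    change ψ j i = ψ i j * τ.label _
    rw [← τ.longLabel_of_ne hij]
    by_cases hi : i = 0
    · subst hi
      rw [h0, h1 _ _ hij.symm]
      simp
    by_cases hj : j = 0
    · subst hj
      rw [h0, h1 _ _ hij, τ.longLabel_symm hij.symm]
      simp
    rw [h1 _ _ hi, h1 _ _ hj, ← τ.shortLabel_trans h01 (Ne.symm hi) (Ne.symm hj)]
    have h := τ.longLabel_trans (t := s) (Ne.symm hi) hij hj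
    simp only [mul_assoc] at h ⊢
    rw [h]
  · obtain rfl : s = t := hs
    change ψ k j = ψ k i * τ.label _
    rw [← τ.shortLabel_of_ne hki hkj hij]
    by_cases hk : k = 0
    · subst hk
      rw [h0, h0, τ.shortLabel_trans h01 hki hkj]
    · rw [h1 _ _ hk, h1 _ _ hk, mul_assoc _ _ (τ.shortLabel s k i j),
        τ.shortLabel_trans hk hki hkj]

/-- A potential of the cocycle on the `t`-th simplex. -/
def potential (t : Fin T.n) : Corner → SL2C := (τ.exists_potential t).choose

theorem potential_target (e : OrientedEdge T.n) :
    τ.potential e.tet e.target = τ.potential e.tet e.source * τ.label e :=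
  (τ.exists_potential e.tet).choose_spec e rfl

theorem coset_potential {c d : Corner} (h : c.near = d.near) :
    ((τ.potential t c : SL2C) : SL2C ⧸ P) = τ.potential t d := by
  obtain ⟨k, i, hki⟩ := c
  obtain ⟨k', j, hkj⟩ := d
  obtain rfl : k = k' := h
  by_cases hij : i = j
  · subst hij; rfl
  · have h := τ.potential_target (.short t k i j hki hkj hij)
    simp only [OrientedEdge.tet, OrientedEdge.target, OrientedEdge.source] at h
    rw [h, QuotientGroup.eq, inv_mul_cancel_left]
    exact τ.short_mem _ _ _ _ _ _ _

/-- The discrepancy of the potentials of two adjacent simplices at corners glued to each other is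
the same for all corners of the common face. -/
theorem potential_discrepancy {f : Fin 4} {c d : Corner} (hc : f ≠ c.near) (hc' : f ≠ c.dir)
    (hd : f ≠ d.near) (hd' : f ≠ d.dir) :
    τ.potential t c * (τ.potential (T.pairing.adj t f) (c.map (T.pairing.perm t f)))⁻¹ =
      τ.potential t d * (τ.potential (T.pairing.adj t f) (d.map (T.pairing.perm t f)))⁻¹ := by
  have hlong : ∀ (k i : Fin 4) (hki : k ≠ i), f ≠ k → f ≠ i →
      τ.potential t ⟨k, i, hki⟩ * (τ.potential (T.pairing.adj t f)
        (Corner.map (T.pairing.perm t f) ⟨k, i, hki⟩))⁻¹ =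
      τ.potential t ⟨i, k, hki.symm⟩ * (τ.potential (T.pairing.adj t f)
        (Corner.map (T.pairing.perm t f) ⟨i, k, hki.symm⟩))⁻¹ := by
    intro k i hki hk hi
    have hg := FacePairing.EdgeGlued.long (F := T.pairing) t f k i hk hi hki
    have h1 := τ.potential_target (.long t k i hki)
    have h2 := τ.potential_target (.long (T.pairing.adj t f) (T.pairing.perm t f k)
      (T.pairing.perm t f i) ((T.pairing.perm t f).injective.ne hki))
    rw [← τ.label_glued _ _ hg] at h2
    simp only [OrientedEdge.tet, OrientedEdge.target, OrientedEdge.source] at h1 h2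
    simp only [Corner.map]
    rw [h1, h2]
    group
  have hshort : ∀ (k i j : Fin 4) (hki : k ≠ i) (hkj : k ≠ j), f ≠ k → f ≠ i → f ≠ j →
      τ.potential t ⟨k, i, hki⟩ * (τ.potential (T.pairing.adj t f)
        (Corner.map (T.pairing.perm t f) ⟨k, i, hki⟩))⁻¹ =
      τ.potential t ⟨k, j, hkj⟩ * (τ.potential (T.pairing.adj t f)
        (Corner.map (T.pairing.perm t f) ⟨k, j, hkj⟩))⁻¹ := by
    intro k i j hki hkj hk hi hj
    by_cases hij : i = j
    · subst hij; rfl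
    have hg := FacePairing.EdgeGlued.short (F := T.pairing) t f k i j hk hi hj hki hkj hij
    have h1 := τ.potential_target (.short t k i j hki hkj hij)
    have h2 := τ.potential_target (.short (T.pairing.adj t f) (T.pairing.perm t f k)
      (T.pairing.perm t f i) (T.pairing.perm t f j) ((T.pairing.perm t f).injective.ne hki)
      ((T.pairing.perm t f).injective.ne hkj) ((T.pairing.perm t f).injective.ne hij))
    rw [← τ.label_glued _ _ hg] at h2
    simp only [OrientedEdge.tet, OrientedEdge.target, OrientedEdge.source] at h1 h2
    simp only [Corner.map]
    rw [h1, h2]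
    group
  obtain ⟨k, i, hki⟩ := c
  obtain ⟨l, j, hlj⟩ := d
  dsimp only at hc hc' hd hd'
  by_cases hkl : k = l
  · subst hkl
    exact hshort k i j hki hlj hc hc' hd'
  · rw [hshort k i l hki hkl hc hc' hd, hlong k l hkl hc hd,
      hshort l k j (Ne.symm hkl) hlj hd hc hd']

open Classical in
/-- The transition element of the flat bundle of a cocycle across a face: the discrepancy of the
potentials at the corners of this face. -/
def transition (t : Fin T.n) (f : Fin 4) : SL2C :=
  if h : ∃ c : Corner, f ≠ c.near ∧ f ≠ c.dir then
    τ.potential t h.choose *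
      (τ.potential (T.pairing.adj t f) (h.choose.map (T.pairing.perm t f)))⁻¹ else 1

theorem potential_map {f : Fin 4} {c : Corner} (hc : f ≠ c.near) (hc' : f ≠ c.dir) :
    τ.potential (T.pairing.adj t f) (c.map (T.pairing.perm t f)) =
      (τ.transition t f)⁻¹ * τ.potential t c := by
  have h : ∃ c : Corner, f ≠ c.near ∧ f ≠ c.dir := ⟨c, hc, hc'⟩
  rw [transition, dif_pos h, τ.potential_discrepancy h.choose_spec.1 h.choose_spec.2 hc hc']
  group

end BruhatCocycle

/-! ### The flat bundle of a cocycle -/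

namespace BruhatCocycle

variable {M : Type*} [TopologicalSpace M] {T : IdealTriangulation M} (τ : BruhatCocycle T)

/-- The gluing of the copies of the truncated simplices indexed by the elements of `SL(2, ℂ)`. -/
def BundleRel (a b : Σ _ : SL2C, Fin T.n × TruncatedSimplex) : Prop :=
  ∃ f, a.2.2.1 f = 0 ∧ b = ⟨a.1 * τ.transition a.2.1 f, T.pairing.glue f a.2⟩

/-- The flat principal `SL(2, ℂ)`-bundle of a cocycle, where `SL(2, ℂ)` has the discrete topology
and acts from the left.  It is glued from copies of the truncated simplices. -/
def FlatBundle : Type := Quot τ.BundleRel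

instance : TopologicalSpace τ.FlatBundle :=
  inferInstanceAs (TopologicalSpace (Quot τ.BundleRel))

namespace FlatBundle

variable {τ}

variable (τ) in
/-- The point of the bundle represented by the point `p` of the copy of index `g`. -/
def mk (g : SL2C) (p : Fin T.n × TruncatedSimplex) : τ.FlatBundle := Quot.mk _ ⟨g, p⟩

theorem mk_glue (g : SL2C) (p : Fin T.n × TruncatedSimplex) {f : Fin 4} (hf : p.2.1 f = 0) :
    mk τ (g * τ.transition p.1 f) (T.pairing.glue f p) = mk τ g p :=
  (Quot.sound ⟨f, hf, rfl⟩).symm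

theorem exists_rep (e : τ.FlatBundle) : ∃ g p, e = mk τ g p := by
  obtain ⟨⟨g, p⟩, rfl⟩ := Quot.exists_rep e
  exact ⟨g, p, rfl⟩

theorem continuous_mk (g : SL2C) : Continuous (mk τ g) :=
  continuous_quot_mk.comp continuous_sigmaMk

theorem isOpen_iff {s : Set τ.FlatBundle} : IsOpen s ↔ ∀ g, IsOpen (mk τ g ⁻¹' s) := by
  refine (isQuotientMap_quot_mk (r := τ.BundleRel)).isOpen_preimage.symm.trans ?_
  rw [isOpen_sigma_iff]
  rfl

variable (τ) in
/-- The projection of the bundle. -/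
def proj : τ.FlatBundle → M :=
  Quot.lift (fun a => T.cell a.2.1 a.2.2) (by
    rintro a _ ⟨f, hf, rfl⟩
    exact (T.cell_glue f a.2 hf).symm)

theorem isQuotientMap_proj : IsQuotientMap (proj τ) := by
  rw [isQuotientMap_iff, isCoinducing_iff]
  refine ⟨fun s => ?_, fun m => ?_⟩
  · rw [isOpen_iff, ← T.isQuotientMap_cell.isOpen_preimage]
    exact ⟨fun h => h 1, fun h _ => h⟩
  · obtain ⟨p, hp⟩ := T.cell_surjective m
    exact ⟨mk τ 1 p, hp⟩

instance : MulAction SL2C τ.FlatBundle where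
  smul g := Quot.map (fun a => ⟨g * a.1, a.2⟩) (by
    rintro a _ ⟨f, hf, rfl⟩
    exact ⟨f, hf, by simp [mul_assoc]⟩)
  one_smul := by
    rintro ⟨a⟩
    exact congrArg (Quot.mk _) (by simp)
  mul_smul := by
    rintro g h ⟨a⟩
    exact congrArg (Quot.mk _) (by simp [mul_assoc])

@[simp] theorem smul_mk (g h : SL2C) (p : Fin T.n × TruncatedSimplex) :
    g • mk τ h p = mk τ (g * h) p := rfl

theorem exists_eq_mk {e : τ.FlatBundle} {p : Fin T.n × TruncatedSimplex}
    (h : proj τ e = T.cell p.1 p.2) : ∃ g, e = mk τ g p := by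
  obtain ⟨g, q, rfl⟩ := exists_rep e
  refine T.induction_of_cell_eq (p := q) (q := p) (C := fun p => ∃ h, mk τ g q = mk τ h p) ?_ h
    ⟨g, rfl⟩
  rintro p f hf ⟨h, hp⟩
  exact ⟨_, hp.trans (mk_glue h p hf).symm⟩

/-- The translates of a small neighborhood of a point of the bundle are disjoint: over a star, the
bundle has a coordinate with values in `SL(2, ℂ)`, obtained from the potentials at the corners
chosen in `exists_corner_section`. -/
theorem exists_disjoint_nhd (e : τ.FlatBundle) :
    ∃ U ∈ 𝓝 e, ∀ g : SL2C, ((g • ·) '' U ∩ U).Nonempty → g = 1 := by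
  obtain ⟨g₀, p₀, rfl⟩ := exists_rep e
  obtain ⟨S⟩ := T.nonempty_star (T.cell p₀.1 p₀.2)
  obtain ⟨c, hc⟩ := T.exists_corner_section (T.cell p₀.1 p₀.2)
  let coord : Fin T.n × TruncatedSimplex → SL2C := fun p =>
    τ.potential p.1 (c (p.1, S.center p))
  have hcoord : ∀ p ∈ S.carrier, ∀ f, p.2.1 f = 0 →
      τ.transition p.1 f * coord (T.pairing.glue f p) = coord p := by
    intro p hp f hf
    obtain ⟨⟨h1, h2⟩, h3⟩ := hc (p.1, S.center p) (S.cell_center p hp) f (S.center_face p hp f hf)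
    have h4 : ((T.pairing.glue f p).1, S.center (T.pairing.glue f p)) =
        T.pairing.glue f (p.1, S.center p) := by
      rw [S.center_glue p hp f hf]
      rfl
    simp only [coord]
    rw [h4, h3]
    change _ * τ.potential (T.pairing.adj p.1 f) _ = _
    rw [τ.potential_map h1 h2]
    group
  have hiff : ∀ p f, p.2.1 f = 0 → (T.pairing.glue f p ∈ S.carrier ↔ p ∈ S.carrier) :=
    fun p f hf => ⟨S.mem_of_cell_eq (T.cell_glue f p hf), S.mem_of_cell_eq (T.cell_glue f p hf).symm⟩
  let U : Set τ.FlatBundle := {e | Quot.lift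
    (fun a => a.2 ∈ S.carrier ∧ a.1 * coord a.2 = g₀ * coord p₀) (by
      rintro a _ ⟨f, hf, rfl⟩
      refine propext (Iff.symm ((and_congr_left' (hiff _ f hf)).trans
        (and_congr_right fun h => ?_)))
      rw [mul_assoc, hcoord _ h f hf]) e}
  have hU : ∀ g p, mk τ g p ∈ U ↔ p ∈ S.carrier ∧ g * coord p = g₀ * coord p₀ :=
    fun g p => Iff.rfl
  have hopen : IsOpen U := by
    rw [isOpen_iff]
    intro g
    rw [isOpen_iff_mem_nhds]
    intro p hp
    obtain ⟨h1, h2⟩ := (hU g p).1 hp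
    filter_upwards [S.isOpen.mem_nhds h1, S.eventually_center p h1] with q hq hq'
    refine (hU g q).2 ⟨hq, ?_⟩
    simp only [coord, hq'.1, hq'.2]
    exact h2
  refine ⟨U, hopen.mem_nhds ((hU _ _).2 ⟨S.mem _ rfl, rfl⟩), ?_⟩
  rintro g ⟨_, ⟨e, he, rfl⟩, he'⟩
  obtain ⟨h, p, rfl⟩ := exists_rep e
  dsimp only at he'
  rw [smul_mk, hU, mul_assoc, ((hU h p).1 he).2] at he'
  exact mul_eq_right.1 he'.2

variable (τ) in
theorem isQuotientCoveringMap : IsQuotientCoveringMap (proj τ) SL2C where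
  toIsQuotientMap := isQuotientMap_proj
  continuous_const_smul g := by
    refine continuous_coinduced_dom.2 (continuous_sigma fun h => ?_)
    exact continuous_mk (g * h)
  apply_eq_iff_mem_orbit := by
    intro e₁ e₂
    constructor
    · intro h
      obtain ⟨g, p, rfl⟩ := exists_rep e₂
      obtain ⟨k, rfl⟩ := exists_eq_mk h
      exact ⟨k * g⁻¹, by simp⟩
    · rintro ⟨g, rfl⟩
      obtain ⟨h, p, rfl⟩ := exists_rep e₂
      rfl
  disjoint := exists_disjoint_nhd

/-! ### The holonomy of a cocycle -/

/-- The parallel transport in the bundle. -/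
def transport {x y : M} (γ : Path.Homotopic.Quotient x y) : proj τ ⁻¹' {x} → proj τ ⁻¹' {y} :=
  (isQuotientCoveringMap τ).isCoveringMap.monodromy γ

/-- The action of `SL(2, ℂ)` on a fiber of the bundle. -/
instance (x : M) : MulAction SL2C (proj τ ⁻¹' {x}) :=
  (isQuotientCoveringMap τ).mulActionFiber x

@[simp] theorem coe_smul {x : M} (g : SL2C) (e : proj τ ⁻¹' {x}) :
    ((g • e : proj τ ⁻¹' {x}) : τ.FlatBundle) = g • (e : τ.FlatBundle) := rfl

theorem transport_smul {x y : M} (γ : Path.Homotopic.Quotient x y) (g : SL2C)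
    (e : proj τ ⁻¹' {x}) : transport γ (g • e) = g • transport γ e :=
  (isQuotientCoveringMap τ).monodromy_toPermFiber

theorem transport_trans {x y z : M} (γ : Path.Homotopic.Quotient x y)
    (δ : Path.Homotopic.Quotient y z) (e : proj τ ⁻¹' {x}) :
    transport (γ.trans δ) e = transport δ (transport γ e) :=
  (isQuotientCoveringMap τ).isCoveringMap.monodromy_trans_apply γ δ e

theorem transport_refl {x : M} (e : proj τ ⁻¹' {x}) : transport (.refl x) e = e :=
  congrFun (isQuotientCoveringMap τ).isCoveringMap.monodromy_refl e

theorem transport_symm_transport {x y : M} (γ : Path.Homotopic.Quotient x y)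
    (e : proj τ ⁻¹' {x}) : transport γ.symm (transport γ e) = e := by
  rw [← transport_trans, Path.Homotopic.Quotient.trans_symm, transport_refl]

theorem exists_smul_eq {x : M} (e e' : proj τ ⁻¹' {x}) : ∃ g : SL2C, g • e = e' :=
  ((isQuotientCoveringMap τ).mulActionFiber_isPretransitive x).exists_smul_eq e e'

theorem smul_left_cancel {x : M} {g h : SL2C} (e : proj τ ⁻¹' {x}) (H : g • e = h • e) : g = h :=
  (isQuotientCoveringMap τ).toPermFiber_ext x e H

/-- The holonomy of the bundle at a point `e` of the fiber over the base point. -/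
def holonomy {x₀ : M} (e : proj τ ⁻¹' {x₀}) : PiOne M x₀ →* SL2C where
  toFun a := ((isQuotientCoveringMap τ).fundamentalGroupToMulOpposite e a.unop).unop
  map_one' := congrArg MulOpposite.unop (map_one _)
  map_mul' a b := congrArg MulOpposite.unop (map_mul _ b.unop a.unop)

theorem holonomy_smul {x₀ : M} (e : proj τ ⁻¹' {x₀}) (a : PiOne M x₀) :
    holonomy e a • e = transport a.loop e :=
  Subtype.ext (isQuotientCoveringMap τ).unop_fundamentalGroupToMulOpposite_smul

/-- The point of the fiber over a vertex in terms of which the parallel transport along edges is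
given by the labels. -/
def atCorner (t : Fin T.n) (c : Corner) : τ.FlatBundle := mk τ (τ.potential t c)⁻¹ (t, c.point)

theorem atCorner_eq {t t' : Fin T.n} {c c' : Corner}
    (h : T.cell t c.point = T.cell t' c'.point) :
    (atCorner t c : τ.FlatBundle) = atCorner t' c' := by
  refine T.corner_induction (C := fun s d => (atCorner t c : τ.FlatBundle) = atCorner s d) ?_ h rfl
  intro s d f h1 h2 h
  rw [h, atCorner, atCorner, ← mk_glue _ (s, d.point) ((d.point_eq_zero_iff f).2 ⟨h1, h2⟩),
    τ.potential_map h1 h2, mul_inv_rev, inv_inv, ← d.permPoint_point]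
  rfl

variable (τ) in
/-- The point `atCorner` of the fiber over a vertex. -/
def atVertex (v : T.vertices) : proj τ ⁻¹' {(v : M)} :=
  ⟨atCorner v.2.choose v.2.choose_spec.choose, v.2.choose_spec.choose_spec⟩

theorem coe_atVertex (v : T.vertices) {t : Fin T.n} {c : Corner} (h : T.cell t c.point = v) :
    (atVertex τ v : τ.FlatBundle) = atCorner t c :=
  atCorner_eq (v.2.choose_spec.choose_spec.trans h.symm)

theorem transport_edge (e : OrientedEdge T.n) :
    transport (.mk (T.edge e)) (atVertex τ (T.source e)) =
      τ.label e • atVertex τ (T.target e) := by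
  let Γ : Path (atVertex τ (T.source e)).1 (τ.label e • atVertex τ (T.target e)).1 :=
    { toFun := fun s => mk τ (τ.potential e.tet e.source)⁻¹
        (e.tet, straightPath e.source.point e.target.point s)
      continuous_toFun := (continuous_mk _).comp
        (continuous_const.prodMk (straightPath _ _).continuous)
      source' := by
        rw [Path.source, coe_atVertex (T.source e) rfl]
        rfl
      target' := by
        rw [Path.target, coe_smul, coe_atVertex (T.target e) rfl, atCorner, smul_mk,
          τ.potential_target, mul_inv_rev, mul_inv_cancel_left] }
  refine (isQuotientCoveringMap τ).isCoveringMap.monodromy_eq_of_map_eq (.mk Γ) ?_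
  exact congrArg Path.Homotopic.Quotient.mk (Path.ext rfl)

theorem transport_edgePath {v w : T.vertices} (p : T.EdgePath v w) :
    transport p.homotopyClass (atVertex τ v) = τ.along p • atVertex τ w := by
  induction p with
  | nil v => rw [IdealTriangulation.EdgePath.homotopyClass, transport_refl, along, one_smul]
  | cons e h p ih =>
    subst h
    rw [IdealTriangulation.EdgePath.homotopyClass, Path.Homotopic.Quotient.cast_rfl_rfl,
      transport_trans, transport_edge, transport_smul, ih, along, mul_smul]

/-! ### The decoration given by a cocycle -/

/-- Near the boundary, a point of a simplex is close to only one of its vertices. -/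
theorem index_unique {x : TruncatedSimplex} {k l : Fin 4} (hk : 1 / 2 < x.1 k)
    (hl : 1 / 2 < x.1 l) : k = l := by
  by_contra hne
  have h1 := x.2.1.2
  have h2 := Finset.sum_le_univ_sum_of_nonneg x.2.1.1 (s := {k, l})
  rw [h1, Finset.sum_pair hne] at h2
  linarith

open Classical in
variable (τ) in
/-- The reduction of the bundle to `P` near the boundary.  (It has no meaning away from it.) -/
def coset : τ.FlatBundle → SL2C ⧸ P :=
  Quot.lift (fun a => if h : ∃ c : Corner, 1 / 2 < a.2.2.1 c.near then
      a.1 • (τ.potential a.2.1 h.choose : SL2C ⧸ P) else ((1 : SL2C) : SL2C ⧸ P)) (by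
    rintro ⟨g, p⟩ _ ⟨f, hf, rfl⟩
    dsimp only at hf ⊢
    by_cases h : ∃ c : Corner, 1 / 2 < p.2.1 c.near
    · obtain ⟨c, hc⟩ := id h
      have hfc : f ≠ c.near := by
        rintro rfl
        rw [hf] at hc
        norm_num at hc
      obtain ⟨i, hi, hi'⟩ : ∃ i, c.near ≠ i ∧ f ≠ i := by
        have : ∀ a b : Fin 4, ∃ i, a ≠ i ∧ b ≠ i := by decide
        exact this _ _
      have h' : ∃ c : Corner, 1 / 2 < (T.pairing.glue f p).2.1 c.near :=
        ⟨c.map (T.pairing.perm p.1 f), by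
          simp only [Corner.map, T.pairing.glue_apply_perm]; exact hc⟩
      rw [dif_pos h, dif_pos h']
      have e1 := τ.coset_potential (t := p.1) (c := h.choose) (d := ⟨c.near, i, hi⟩)
        (index_unique h.choose_spec hc)
      have e2 := τ.coset_potential (t := (T.pairing.glue f p).1) (c := h'.choose)
        (d := Corner.map (T.pairing.perm p.1 f) ⟨c.near, i, hi⟩)
        (index_unique h'.choose_spec (by
          simp only [Corner.map, T.pairing.glue_apply_perm]; exact hc))
      rw [e1, e2]
      change _ = _ • ((τ.potential (T.pairing.adj p.1 f) _ : SL2C) : SL2C ⧸ P)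
      rw [τ.potential_map (c := ⟨c.near, i, hi⟩) hfc hi']
      simp only [MulAction.Quotient.smul_coe, smul_eq_mul]
      group
    · have h' : ¬ ∃ c : Corner, 1 / 2 < (T.pairing.glue f p).2.1 c.near := by
        rintro ⟨c, hc⟩
        refine h ⟨c.map (T.pairing.perm p.1 f)⁻¹, ?_⟩
        rw [← T.pairing.glue_apply_perm f p]
        simpa [Corner.map] using hc
      rw [dif_neg h, dif_neg h'])

theorem coset_mk (g : SL2C) {p : Fin T.n × TruncatedSimplex} {c : Corner}
    (hc : 1 / 2 < p.2.1 c.near) :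
    coset τ (mk τ g p) = g • (τ.potential p.1 c : SL2C ⧸ P) := by
  have h : ∃ c : Corner, 1 / 2 < p.2.1 c.near := ⟨c, hc⟩
  refine (dif_pos h).trans ?_
  rw [τ.coset_potential (c := h.choose) (d := c) (index_unique h.choose_spec hc)]

theorem exists_boundary_rep {e : τ.FlatBundle} (he : proj τ e ∈ T.boundary) :
    ∃ g p, ∃ c : Corner, e = mk τ g p ∧ 1 / 2 < p.2.1 c.near := by
  obtain ⟨t, x, k, hk, hx⟩ := he
  obtain ⟨g, rfl⟩ := exists_eq_mk (p := (t, x)) hx.symm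
  obtain ⟨i, hi⟩ := exists_ne k
  exact ⟨g, (t, x), ⟨k, i, hi.symm⟩, rfl, by dsimp only; rw [hk]; norm_num⟩

theorem coset_smul (g : SL2C) {e : τ.FlatBundle} (he : proj τ e ∈ T.boundary) :
    coset τ (g • e) = g • coset τ e := by
  obtain ⟨h, p, c, rfl, hc⟩ := exists_boundary_rep he
  rw [smul_mk, coset_mk _ hc, coset_mk _ hc, mul_smul]

theorem coset_atVertex (v : T.vertices) : coset τ (atVertex τ v) = ((1 : SL2C) : SL2C ⧸ P) := by
  obtain ⟨_, t, c, rfl⟩ := v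
  rw [coe_atVertex _ (t := t) (c := c) rfl, atCorner, coset_mk (c := c) _ (by
    rw [Corner.point_near]; norm_num), MulAction.Quotient.smul_coe, smul_eq_mul, inv_mul_cancel]

/-- Near the boundary, `coset` is locally constant. -/
theorem isOpen_coset (k : SL2C ⧸ P) :
    IsOpen {e : τ.FlatBundle | (∃ g p, ∃ c : Corner, e = mk τ g p ∧ 1 / 2 < p.2.1 c.near) ∧
      coset τ e = k} := by
  rw [isOpen_iff]
  intro g
  rw [isOpen_iff_mem_nhds]
  rintro p ⟨⟨h, q, c, he, hc⟩, hk⟩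
  have hr := T.range_eq_of_cell_eq (p := q) (q := p) (congrArg (proj τ) he).symm
  obtain ⟨l, hl⟩ : q.2.1 c.near ∈ range p.2.1 := hr ▸ mem_range_self _
  obtain ⟨i, hi⟩ := exists_ne l
  have hcont : Continuous fun q : Fin T.n × TruncatedSimplex => q.2.1 l :=
    (continuous_apply l).comp (continuous_subtype_val.comp continuous_snd)
  have h1 : ∀ᶠ q : Fin T.n × TruncatedSimplex in 𝓝 p, 1 / 2 < q.2.1 l :=
    hcont.continuousAt.eventually (lt_mem_nhds (show _ < p.2.1 l by rw [hl]; exact hc))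
  have h2 : ∀ᶠ q : Fin T.n × TruncatedSimplex in 𝓝 p, q.1 = p.1 :=
    continuous_fst.continuousAt.eventually
      (show ∀ᶠ s in 𝓝 p.1, s = p.1 by rw [nhds_discrete]; rfl)
  filter_upwards [h1, h2] with q hq hq'
  refine ⟨⟨g, q, ⟨l, i, hi.symm⟩, rfl, hq⟩, ?_⟩
  rw [← hk, coset_mk (c := ⟨l, i, hi.symm⟩) g hq,
    coset_mk (p := p) (c := ⟨l, i, hi.symm⟩) g (by dsimp only; rw [hl]; exact hc), hq']

/-- The reduction to `P` is parallel along the boundary. -/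
theorem coset_transport_pushSub {b b' : T.boundary} (d : Path.Homotopic.Quotient b b')
    (e : proj τ ⁻¹' {(b : M)}) : coset τ (transport (pushSub d) e) = coset τ e := by
  induction d using Path.Homotopic.Quotient.ind with | mk d =>
  let cov := (isQuotientCoveringMap τ).isCoveringMap
  let γ : Path (b : M) (b' : M) := d.map continuous_subtype_val
  let Γ := cov.liftPath γ e (γ.source.trans e.2.symm)
  have hΓ : ∀ s, proj τ (Γ s) ∈ T.boundary := by
    intro s
    have : proj τ (Γ s) = γ s := congrFun (cov.liftPath_lifts γ e (γ.source.trans e.2.symm)) s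
    rw [this]
    exact (d s).2
  have hconst : IsLocallyConstant fun s => coset τ (Γ s) := by
    rw [IsLocallyConstant.iff_exists_open]
    intro s
    refine ⟨_, (isOpen_coset (coset τ (Γ s))).preimage Γ.continuous,
      ⟨exists_boundary_rep (hΓ s), rfl⟩, fun s' hs' => hs'.2⟩
  have h0 : Γ 0 = e := cov.liftPath_zero γ e (γ.source.trans e.2.symm)
  have h1 : ((transport (pushSub (.mk d)) e : proj τ ⁻¹' {(b' : M)}) : τ.FlatBundle) = Γ 1 := rfl
  rw [h1, ← h0]
  exact hconst.apply_eq_of_isPreconnected isPreconnected_univ (mem_univ _) (mem_univ _)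

/-- The decorated representation given by the holonomy of the bundle at a point `e` of the fiber
over the base point. -/
def decoratedRep {x₀ : M} (e : proj τ ⁻¹' {x₀}) : DecoratedRep T.boundary x₀ :=
  let D : IdealPoint T.boundary x₀ → SL2C ⧸ P :=
    Quotient.lift (fun p : CoverPoint T.boundary x₀ => coset τ (transport p.2 e)) (by
      rintro p q ⟨d, hd⟩
      rw [hd, transport_trans, coset_transport_pushSub])
  have hD : ∀ (a : PiOne M x₀) (p : IdealPoint T.boundary x₀),
      D (p.translate a) = holonomy e a • D p := by
    rintro a ⟨b, c⟩
    change coset τ (transport (a.loop.trans c) e) = holonomy e a • coset τ (transport c e)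
    rw [transport_trans, ← holonomy_smul, transport_smul, coe_smul, coset_smul]
    rw [(transport c e).2]
    exact b.2
  { ρ := holonomy e
    boundaryUnipotent := by
      intro b c
      obtain ⟨g, hg⟩ := QuotientGroup.mk_surjective (D (IdealPoint.mk b c))
      refine ⟨g, fun d => ?_⟩
      -- a loop in the boundary fixes the corresponding ideal point
      have h : IdealPoint.translate (PiOne.ofLoop ((c.trans (pushSub d)).trans c.symm))
          (IdealPoint.mk b c) = IdealPoint.mk b c := by
        refine (Quotient.sound (s := coverSetoid T.boundary x₀) ⟨d, ?_⟩).symm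
        change (((c.trans (pushSub d)).trans c.symm).trans c) = _
        rw [Path.Homotopic.Quotient.trans_assoc, Path.Homotopic.Quotient.symm_trans,
          Path.Homotopic.Quotient.trans_refl]
      have h' := hD (PiOne.ofLoop ((c.trans (pushSub d)).trans c.symm)) (IdealPoint.mk b c)
      rw [h, ← hg, MulAction.Quotient.smul_coe, smul_eq_mul, QuotientGroup.eq, ← mul_assoc] at h'
      exact h'
    D := D
    equivariant := hD }

theorem decoratedRep_D {x₀ : M} (e : proj τ ⁻¹' {x₀}) (b : T.boundary)
    (c : Path.Homotopic.Quotient x₀ (b : M)) :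
    (decoratedRep e).D (IdealPoint.mk b c) = coset τ (transport c e) := rfl

end FlatBundle

open FlatBundle in
/-- A cocycle is compatible with the holonomy of its flat bundle, decorated by `coset`. -/
theorem exists_decoratedRep [PathConnectedSpace M] (x₀ : M) :
    ∃ X : DecoratedRep T.boundary x₀, τ.IsCompatible X := by
  obtain ⟨e, he⟩ := (isQuotientMap_proj (τ := τ)).surjective x₀
  obtain ⟨⟨t, _⟩, -⟩ := T.cell_surjective x₀
  let v : T.vertices := ⟨T.cell t (Corner.mk 0 1 (by decide)).point, t, _, rfl⟩
  let c : Path.Homotopic.Quotient x₀ (v : M) := .mk (PathConnectedSpace.somePath x₀ v)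
  let e₀ : proj τ ⁻¹' {x₀} := ⟨e, he⟩
  obtain ⟨g, hg⟩ := exists_smul_eq (atVertex τ v) (transport c e₀)
  refine ⟨decoratedRep e₀, v, c, g, fun p => ?_, fun w p => ?_⟩
  · refine smul_left_cancel e₀ ((holonomy_smul e₀ _).trans ?_)
    change transport ((c.trans p.homotopyClass).trans c.symm) e₀ = _
    rw [transport_trans, transport_trans, ← hg, transport_smul, transport_edgePath, ← mul_smul]
    have h : atVertex τ v = g⁻¹ • transport c e₀ := by rw [← hg, inv_smul_smul]
    rw [h, ← mul_smul, transport_smul, transport_symm_transport]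
  · rw [decoratedRep_D, transport_trans, ← hg, transport_smul, transport_edgePath, coe_smul,
      coe_smul, ← mul_smul, coset_smul, coset_atVertex]
    · simp only [MulAction.Quotient.smul_coe, smul_eq_mul, mul_one]
    · rw [(atVertex τ w).2]
      exact T.vertices_subset_boundary w.2

end BruhatCocycle

/-! ### Edge paths represent all homotopy classes -/

instance : SimplyConnectedSpace TruncatedSimplex :=
  have : ContractibleSpace TruncatedSimplex := convex_truncatedSimplex.contractibleSpace
    ⟨_, (Corner.mk 0 1 (by decide)).point.2⟩
  inferInstance

theorem continuous_straightPath {X : Type*} [TopologicalSpace X] {f g : X → TruncatedSimplex}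
    {h : X → unitInterval} (hf : Continuous f) (hg : Continuous g) (hh : Continuous h) :
    Continuous fun z => straightPath (f z) (g z) (h z) := by
  refine Continuous.subtype_mk ?_ _
  simp only [AffineMap.lineMap_apply_module]
  fun_prop

theorem straightPath_apply (x y : TruncatedSimplex) (s : unitInterval) (a : Fin 4) :
    (straightPath x y s).1 a = (1 - s) * x.1 a + s * y.1 a := by
  change (AffineMap.lineMap x.1 y.1 (s : ℝ) : Fin 4 → ℝ) a = _
  simp [AffineMap.lineMap_apply_module]

theorem permPoint_straightPath (σ : Equiv.Perm (Fin 4)) (x y : TruncatedSimplex)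
    (s : unitInterval) :
    permPoint σ (straightPath x y s) = straightPath (permPoint σ x) (permPoint σ y) s := by
  symm
  rw [eq_permPoint_iff]
  intro a
  simp only [straightPath_apply, permPoint_apply]

namespace IdealTriangulation

variable {M : Type*} [TopologicalSpace M] (T : IdealTriangulation M)

theorem pathConnectedSpace [ConnectedSpace M] (T : IdealTriangulation M) : PathConnectedSpace M := by
  have h1 : LocallyPathConnectedSpace TruncatedSimplex :=
    convex_truncatedSimplex.locallyPathConnectedSpace
  have h2 : LocallyPathConnectedSpace M := T.isQuotientMap_cell.locallyPathConnectedSpace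
  exact PathConnectedSpace.of_locallyPathConnectedSpace

/-- The homotopy class of the image of a straight path in the `t`-th simplex. -/
def cellPath {m m' : M} (t : Fin T.n) (x y : TruncatedSimplex) (h : T.cell t x = m)
    (h' : T.cell t y = m') : Path.Homotopic.Quotient m m' :=
  .mk (((straightPath x y).map (T.continuous_cell t)).cast h.symm h'.symm)

theorem cellPath_trans {m m' m'' : M} (t : Fin T.n) (x y z : TruncatedSimplex)
    (hx : T.cell t x = m) (hy : T.cell t y = m') (hz : T.cell t z = m'') :
    (T.cellPath t x y hx hy).trans (T.cellPath t y z hy hz) = T.cellPath t x z hx hz := by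
  subst hx hy hz
  have h := (SimplyConnectedSpace.paths_homotopic
    ((straightPath x y).trans (straightPath y z)) (straightPath x z)).map
    ⟨T.cell t, T.continuous_cell t⟩
  have h' := Path.Homotopic.Quotient.eq.2 h
  rw [Path.map_trans] at h'
  exact h'

theorem cellPath_self {m : M} (t : Fin T.n) (x : TruncatedSimplex)
    (hx : T.cell t x = m) : T.cellPath t x x hx hx = .refl m := by
  subst hx
  exact Path.Homotopic.Quotient.eq.2 ((SimplyConnectedSpace.paths_homotopic
    (straightPath x x) (Path.refl x)).map ⟨T.cell t, T.continuous_cell t⟩)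

theorem mk_edge (e : OrientedEdge T.n) :
    Path.Homotopic.Quotient.mk (T.edge e) =
      T.cellPath e.tet e.source.point e.target.point rfl rfl := rfl

/-- The vertex of the decomposition given by a corner of a simplex. -/
def vertex (t : Fin T.n) (c : Corner) : T.vertices := ⟨T.cell t c.point, t, c, rfl⟩

variable {T}

/-- The class `a` of paths to a vertex is the class of a straight path from `x` in the `t`-th
simplex to the corner `c`, followed by an edge path. -/
def IsEdgelikeVia {m : M} {w : T.vertices} (a : Path.Homotopic.Quotient m (w : M))
    (t : Fin T.n) (x : TruncatedSimplex) (hx : T.cell t x = m) (c : Corner) : Prop :=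
  ∃ (u : T.vertices) (hu : T.cell t c.point = u) (q : T.EdgePath u w),
    a = (T.cellPath t x c.point hx hu).trans q.homotopyClass

theorem IsEdgelikeVia.of_edge {m : M} {w : T.vertices} {a : Path.Homotopic.Quotient m (w : M)}
    {x : TruncatedSimplex} {e : OrientedEdge T.n} {hx : T.cell e.tet x = m}
    (h : IsEdgelikeVia a e.tet x hx e.target) : IsEdgelikeVia a e.tet x hx e.source := by
  obtain ⟨u, hu, q, rfl⟩ := h
  obtain rfl : T.target e = u := Subtype.ext hu
  refine ⟨T.source e, rfl, .cons e rfl q, ?_⟩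
  have h : (T.cellPath e.tet x e.source.point hx rfl).trans
      (T.cellPath e.tet e.source.point e.target.point rfl hu) =
      T.cellPath e.tet x e.target.point hx hu := T.cellPath_trans _ _ _ _ _ _ _
  rw [EdgePath.homotopyClass, Path.Homotopic.Quotient.cast_rfl_rfl, mk_edge, ← h]
  exact Path.Homotopic.Quotient.trans_assoc _ _ _

theorem IsEdgelikeVia.corner {m : M} {w : T.vertices} {a : Path.Homotopic.Quotient m (w : M)}
    {t : Fin T.n} {x : TruncatedSimplex} {hx : T.cell t x = m} {c : Corner}
    (h : IsEdgelikeVia a t x hx c) (d : Corner) : IsEdgelikeVia a t x hx d := by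
  have hlong : ∀ (k i : Fin 4) (hki : k ≠ i), IsEdgelikeVia a t x hx ⟨k, i, hki⟩ →
      IsEdgelikeVia a t x hx ⟨i, k, hki.symm⟩ := fun k i hki h =>
    IsEdgelikeVia.of_edge (e := .long t i k hki.symm) h
  have hshort : ∀ (k i j : Fin 4) (hki : k ≠ i) (hkj : k ≠ j),
      IsEdgelikeVia a t x hx ⟨k, i, hki⟩ → IsEdgelikeVia a t x hx ⟨k, j, hkj⟩ := by
    intro k i j hki hkj h
    by_cases hij : i = j
    · subst hij; exact h
    · exact IsEdgelikeVia.of_edge (e := .short t k j i hkj hki (Ne.symm hij)) h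
  obtain ⟨k, i, hki⟩ := c
  obtain ⟨l, j, hlj⟩ := d
  by_cases hkl : k = l
  · subst hkl
    exact hshort k i j hki hlj h
  · exact hshort l k j _ hlj (hlong k l hkl (hshort k i l hki hkl h))

theorem IsEdgelikeVia.glue {m : M} {w : T.vertices} {a : Path.Homotopic.Quotient m (w : M)}
    {t : Fin T.n} {x : TruncatedSimplex} {hx : T.cell t x = m} {c : Corner} {f : Fin 4}
    (h : IsEdgelikeVia a t x hx c) (hc : c.point.1 f = 0) (hf : x.1 f = 0) :
    IsEdgelikeVia a (T.pairing.adj t f) (permPoint (T.pairing.perm t f) x)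
      ((T.cell_glue f (t, x) hf).trans hx) (c.map (T.pairing.perm t f)) := by
  obtain ⟨u, hu, q, rfl⟩ := h
  have hu' : T.cell (T.pairing.adj t f) (c.map (T.pairing.perm t f)).point = u := by
    rw [← Corner.permPoint_point]
    exact (T.cell_glue f (t, c.point) hc).trans hu
  refine ⟨u, hu', q, congrArg (Path.Homotopic.Quotient.trans · q.homotopyClass) ?_⟩
  refine congrArg Path.Homotopic.Quotient.mk (Path.ext (funext fun s => ?_))
  change T.cell t (straightPath x c.point s) = T.cell (T.pairing.adj t f)
    (straightPath (permPoint (T.pairing.perm t f) x) (c.map (T.pairing.perm t f)).point s)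
  rw [← Corner.permPoint_point, ← permPoint_straightPath]
  refine (T.cell_glue f (t, straightPath x c.point s) ?_).symm
  rw [straightPath_apply, hf, hc]
  simp

/-- Whether a class of paths is of the form considered in `IsEdgelikeVia` does not depend on
the simplex and the corner in it. -/
theorem IsEdgelikeVia.of_cell_eq {m : M} {w : T.vertices}
    {a : Path.Homotopic.Quotient m (w : M)} {t : Fin T.n} {x : TruncatedSimplex}
    {hx : T.cell t x = m} {c : Corner} (h : IsEdgelikeVia a t x hx c) {t' : Fin T.n}
    {x' : TruncatedSimplex} (hx' : T.cell t' x' = m) (c' : Corner) :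
    IsEdgelikeVia a t' x' hx' c' := by
  obtain ⟨_, d, hd⟩ := T.induction_of_cell_eq (p := (t, x)) (q := (t', x'))
    (C := fun p => ∃ (hp : T.cell p.1 p.2 = m) (d : Corner), IsEdgelikeVia a p.1 p.2 hp d) (by
      rintro ⟨s, y⟩ f hf ⟨hp, d, hd⟩
      obtain ⟨d', hd'⟩ : ∃ d' : Corner, d'.point.1 f = 0 := by
        have : ∀ f : Fin 4, ∃ i j, i ≠ j ∧ f ≠ i ∧ f ≠ j := by decide
        obtain ⟨i, j, hij, hi, hj⟩ := this f
        exact ⟨⟨i, j, hij⟩, (Corner.point_eq_zero_iff _ _).2 ⟨hi, hj⟩⟩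
      exact ⟨_, _, (hd.corner d').glue hd' hf⟩) (hx.trans hx'.symm) ⟨hx, c, h⟩
  exact hd.corner c'

/-- The class `a` of paths to a vertex is represented by a straight path in a simplex followed by an
edge path. -/
def IsEdgelike {m : M} {w : T.vertices} (a : Path.Homotopic.Quotient m (w : M)) : Prop :=
  ∃ t x hx c, IsEdgelikeVia a t x hx c

namespace Star

variable {m : M} (S : T.Star m)

theorem continuous_center : Continuous fun p : S.carrier => S.center p := by
  rw [continuous_iff_continuousAt]
  intro p
  refine ContinuousAt.congr (f := fun _ => S.center p) continuousAt_const ?_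
  have := continuous_subtype_val.continuousAt.eventually (S.eventually_center p p.2)
  filter_upwards [this] with q hq
  exact hq.2.symm

/-- The contraction of a star to its center. -/
theorem exists_contraction : ∃ H : C(S.nhd × unitInterval, M),
    ∀ (p : Fin T.n × TruncatedSimplex) (hp : p ∈ S.carrier) (s : unitInterval),
      H (⟨T.cell p.1 p.2, p, hp, rfl⟩, s) = T.cell p.1 (straightPath p.2 (S.center p) s) := by
  let q : Fin T.n × TruncatedSimplex → M := fun p => T.cell p.1 p.2
  have hq : IsQuotientMap (S.nhd.restrictPreimage q) :=
    T.isQuotientMap_cell.restrictPreimage_isOpen S.isOpen_nhd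
  let H : S.nhd × unitInterval → M := fun z =>
    T.cell z.1.2.choose.1 (straightPath z.1.2.choose.2 (S.center z.1.2.choose) z.2)
  have hH : ∀ (p : Fin T.n × TruncatedSimplex) (hp : p ∈ S.carrier) (s : unitInterval),
      H (⟨T.cell p.1 p.2, p, hp, rfl⟩, s) = T.cell p.1 (straightPath p.2 (S.center p) s) := by
    intro p hp s
    have hex : ∃ r ∈ S.carrier, T.cell r.1 r.2 = T.cell p.1 p.2 := ⟨p, hp, rfl⟩
    refine (T.induction_of_cell_eq (p := p) (q := hex.choose)
      (C := fun r => r ∈ S.carrier ∧ T.cell r.1 (straightPath r.2 (S.center r) s) =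
        T.cell p.1 (straightPath p.2 (S.center p) s)) ?_ hex.choose_spec.2.symm ⟨hp, rfl⟩).2
    rintro r f hf ⟨hr, h⟩
    refine ⟨S.glue_mem r hr f hf, ?_⟩
    rw [← h, S.center_glue r hr f hf]
    change T.cell (T.pairing.adj r.1 f) (straightPath (permPoint _ r.2) _ s) = _
    rw [← permPoint_straightPath]
    refine T.cell_glue f (r.1, straightPath r.2 (S.center r) s) ?_
    rw [straightPath_apply, hf, S.center_face r hr f hf]
    simp
  refine ⟨⟨H, hq.continuous_lift_prod_left ?_⟩, hH⟩
  have hmem : ∀ p : q ⁻¹' S.nhd, p.1 ∈ S.carrier := fun p => by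
    rw [← S.preimage_nhd]; exact p.2
  have hcont : Continuous fun z : (q ⁻¹' S.nhd) × unitInterval =>
      T.cell z.1.1.1 (straightPath z.1.1.2 (S.center z.1.1) z.2) := by
    have h1 : Continuous fun p : q ⁻¹' S.nhd => S.center p.1 :=
      S.continuous_center.comp (Continuous.subtype_mk continuous_subtype_val hmem)
    have h2 : Continuous fun z : (q ⁻¹' S.nhd) × unitInterval => z.1.1 :=
      continuous_subtype_val.comp continuous_fst
    have h3 : Continuous fun z : (q ⁻¹' S.nhd) × unitInterval =>
        straightPath z.1.1.2 (S.center z.1.1) z.2 :=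
      continuous_straightPath (continuous_snd.comp h2) (h1.comp continuous_fst) continuous_snd
    have h4 : Continuous fun z : (q ⁻¹' S.nhd) × unitInterval =>
        (z.1.1.1, straightPath z.1.1.2 (S.center z.1.1) z.2) :=
      (continuous_fst.comp h2).prodMk h3
    exact T.isQuotientMap_cell.continuous.comp h4
  refine hcont.congr fun z => ?_
  exact (hH z.1.1 (hmem z.1) z.2).symm

/-- A path in a star is homotopic to a straight path to the center followed by a straight path away
from it. -/
theorem mk_trans_cellPath {p p' : Fin T.n × TruncatedSimplex} (hp : p ∈ S.carrier)
    (hp' : p' ∈ S.carrier) (γ : Path (T.cell p.1 p.2) (T.cell p'.1 p'.2))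
    (hγ : ∀ s, γ s ∈ S.nhd) :
    (Path.Homotopic.Quotient.mk γ).trans
      (T.cellPath p'.1 p'.2 (S.center p') rfl (S.cell_center p' hp')) =
      T.cellPath p.1 p.2 (S.center p) rfl (S.cell_center p hp) := by
  obtain ⟨H, hH⟩ := S.exists_contraction
  let Q : C(unitInterval × unitInterval, M) :=
    ⟨fun z => H (⟨γ z.1, hγ z.1⟩, z.2), H.continuous.comp
      ((Continuous.subtype_mk (γ.continuous.comp continuous_fst) _).prodMk continuous_snd)⟩
  have hHeq : ∀ (u u' : S.nhd), u.1 = u'.1 → ∀ s, H (u, s) = H (u', s) :=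
    fun u u' h s => by rw [Subtype.ext h]
  have hQ0 : ∀ s, Q (0, s) = T.cell p.1 (straightPath p.2 (S.center p) s) := by
    intro s
    rw [← hH p hp s]
    exact hHeq ⟨γ 0, hγ 0⟩ ⟨_, p, hp, rfl⟩ γ.source s
  have hQ1 : ∀ s, Q (1, s) = T.cell p'.1 (straightPath p'.2 (S.center p') s) := by
    intro s
    rw [← hH p' hp' s]
    exact hHeq ⟨γ 1, hγ 1⟩ ⟨_, p', hp', rfl⟩ γ.target s
  have hQγ : ∀ s, Q (s, 0) = γ s := by
    intro s
    obtain ⟨r, hr, h⟩ := hγ s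
    have h1 := hH r hr 0
    rw [Path.source] at h1
    exact ((hHeq ⟨γ s, hγ s⟩ ⟨_, r, hr, rfl⟩ h.symm 0).trans h1).trans h
  have hQm : ∀ s, Q (s, 1) = m := by
    intro s
    obtain ⟨r, hr, h⟩ := hγ s
    have h1 := hH r hr 1
    rw [Path.target, S.cell_center r hr] at h1
    exact (hHeq ⟨γ s, hγ s⟩ ⟨_, r, hr, rfl⟩ h.symm 1).trans h1
  let ι : Path (0 : unitInterval) 1 := ⟨⟨id, continuous_id⟩, rfl, rfl⟩
  have : ContractibleSpace unitInterval :=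
    (convex_Icc (0 : ℝ) 1).contractibleSpace ⟨0, unitInterval.zero_mem⟩
  have hsquare : Path.Homotopic ((ι.prod (Path.refl 0)).trans ((Path.refl 1).prod ι))
      (((Path.refl 0).prod ι).trans (ι.prod (Path.refl 1))) :=
    SimplyConnectedSpace.paths_homotopic _ _
  have h := Path.Homotopic.Quotient.eq.2 (hsquare.map Q)
  rw [Path.map_trans, Path.map_trans, Path.Homotopic.Quotient.mk_trans,
    Path.Homotopic.Quotient.mk_trans] at h
  have hcast : ∀ {a b c a' b' c' : M} (A : Path.Homotopic.Quotient a b)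
      (B : Path.Homotopic.Quotient b c) (ha : a' = a) (hb : b' = b) (hc : c' = c),
      (A.cast ha hb).trans (B.cast hb hc) = (A.trans B).cast ha hc := by
    rintro a b c _ _ _ A B rfl rfl rfl
    simp
  have e00 : T.cell p.1 p.2 = Q (0, 0) := by rw [hQ0, Path.source]
  have e10 : T.cell p'.1 p'.2 = Q (1, 0) := by rw [hQ1, Path.source]
  have e01 : m = Q (0, 1) := (hQm 0).symm
  have e11 : m = Q (1, 1) := (hQm 1).symm
  have h1 : Path.Homotopic.Quotient.mk γ =
      (Path.Homotopic.Quotient.mk ((ι.prod (Path.refl 0)).map Q.continuous)).cast e00 e10 :=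
    congrArg Path.Homotopic.Quotient.mk (Path.ext (funext fun s => (hQγ s).symm))
  have h2 : T.cellPath p'.1 p'.2 (S.center p') rfl (S.cell_center p' hp') =
      (Path.Homotopic.Quotient.mk (((Path.refl 1).prod ι).map Q.continuous)).cast e10 e11 :=
    congrArg Path.Homotopic.Quotient.mk (Path.ext (funext fun s => (hQ1 s).symm))
  have h3 : T.cellPath p.1 p.2 (S.center p) rfl (S.cell_center p hp) =
      (Path.Homotopic.Quotient.mk (((Path.refl 0).prod ι).map Q.continuous)).cast e00 e01 :=
    congrArg Path.Homotopic.Quotient.mk (Path.ext (funext fun s => (hQ0 s).symm))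
  have h4 : Path.Homotopic.Quotient.refl m =
      (Path.Homotopic.Quotient.mk ((ι.prod (Path.refl 1)).map Q.continuous)).cast e01 e11 :=
    congrArg Path.Homotopic.Quotient.mk (Path.ext (funext fun s => (hQm s).symm))
  rw [h1, h2, hcast, h, ← hcast _ _ e00 e01 e11, ← h3, ← h4,
    Path.Homotopic.Quotient.trans_refl]

theorem isEdgelike_trans {y y' : M} (γ : Path y y') (hγ : ∀ s, γ s ∈ S.nhd) {w : T.vertices}
    {a : Path.Homotopic.Quotient y' (w : M)} (ha : IsEdgelike a) :
    IsEdgelike ((Path.Homotopic.Quotient.mk γ).trans a) := by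
  obtain ⟨t', x', rfl, c, u, hu, q, rfl⟩ := ha
  obtain ⟨p, hp, hpy⟩ := hγ 0
  rw [γ.source] at hpy
  subst hpy
  have hp' : (t', x') ∈ S.carrier := by
    have := hγ 1
    rw [γ.target] at this
    obtain ⟨r, hr, h⟩ := this
    exact S.mem_of_cell_eq h hr
  -- the part of the path starting at the center of the star can be moved to another simplex
  have hb : IsEdgelikeVia ((T.cellPath t' (S.center (t', x')) c.point
      (S.cell_center _ hp') hu).trans q.homotopyClass) t' (S.center (t', x'))
      (S.cell_center _ hp') c := ⟨u, hu, q, rfl⟩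
  obtain ⟨u', hu', q', hq'⟩ := hb.of_cell_eq (S.cell_center p hp) c
  refine ⟨p.1, p.2, rfl, c, u', hu', q', ?_⟩
  rw [← T.cellPath_trans t' x' (S.center (t', x')) c.point rfl (S.cell_center _ hp') hu,
    Path.Homotopic.Quotient.trans_assoc, hq', ← Path.Homotopic.Quotient.trans_assoc,
    S.mk_trans_cellPath hp hp' γ hγ, ← Path.Homotopic.Quotient.trans_assoc, cellPath_trans]

end Star

theorem isEdgelike_mk {y : M} {w : T.vertices} (γ : Path y (w : M)) :
    IsEdgelike (Path.Homotopic.Quotient.mk γ) := by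
  let rest : ∀ s, Path (γ s) (w : M) := fun s => (γ.subpath s 1).cast rfl γ.target.symm
  let Q : unitInterval → Prop := fun s => IsEdgelike (Path.Homotopic.Quotient.mk (rest s))
  have hloc : IsLocallyConstant Q := by
    rw [IsLocallyConstant.iff_exists_open]
    intro s₀
    obtain ⟨S⟩ := T.nonempty_star (γ s₀)
    obtain ⟨ε, hε, hball⟩ := Metric.isOpen_iff.1 (S.isOpen_nhd.preimage γ.continuous) s₀ S.mem_nhd
    have hstep : ∀ s ∈ Metric.ball s₀ ε, ∀ s' ∈ Metric.ball s₀ ε, Q s' → Q s := by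
      intro s hs s' hs' h
      have hmk : Path.Homotopic.Quotient.mk (rest s) =
          (Path.Homotopic.Quotient.mk (γ.subpath s s')).trans (.mk (rest s')) := by
        have h1 := Path.Homotopic.Quotient.eq.2
          ⟨Path.Homotopy.subpathTransSubpath γ s s' 1⟩
        have h2 := congrArg (fun A => Path.Homotopic.Quotient.cast A rfl γ.target.symm) h1
        exact h2.symm
      change IsEdgelike (Path.Homotopic.Quotient.mk (rest s))
      rw [hmk]
      refine S.isEdgelike_trans _ (fun r => ?_) h
      have hr : γ.subpath s s' r ∈ range (γ.subpath s s') := mem_range_self r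
      rw [Path.range_subpath] at hr
      obtain ⟨r', hr', hγ⟩ := hr
      rw [← hγ]
      refine hball ?_
      rw [Metric.mem_ball, Subtype.dist_eq, Real.dist_eq, abs_lt] at hs hs' ⊢
      have h1 := hr'.1
      have h2 := hr'.2
      rw [← Subtype.coe_le_coe] at h1 h2
      rcases le_total s s' with hle | hle
      · rw [inf_eq_left.2 hle] at h1
        rw [sup_eq_right.2 hle] at h2
        constructor <;> linarith
      · rw [inf_eq_right.2 hle] at h1
        rw [sup_eq_left.2 hle] at h2
        constructor <;> linarith
    refine ⟨Metric.ball s₀ ε, Metric.isOpen_ball, Metric.mem_ball_self hε, fun s hs => ?_⟩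
    exact propext ⟨hstep _ (Metric.mem_ball_self hε) _ hs, hstep _ hs _ (Metric.mem_ball_self hε)⟩
  have h1 : Q 1 := by
    obtain ⟨_, t, c, rfl⟩ := w
    have : Path.Homotopic.Quotient.mk (rest 1) =
        (T.cellPath t c.point c.point γ.target.symm rfl).trans (.refl _) := by
      rw [Path.Homotopic.Quotient.trans_refl]
      have h2 := congrArg (fun A => Path.Homotopic.Quotient.cast A γ.target rfl)
        (T.cellPath_self t c.point rfl)
      refine Eq.trans ?_ h2.symm
      refine congrArg Path.Homotopic.Quotient.mk (Path.ext (funext fun s => ?_))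
      change γ.subpath 1 1 s = T.cell t c.point
      rw [Path.subpath_self]
      exact γ.target
    exact ⟨t, c.point, γ.target.symm, c, ⟨_, t, c, rfl⟩, rfl, .nil _, this⟩
  have h0 : Q 0 := by
    rwa [hloc.apply_eq_of_isPreconnected isPreconnected_univ (mem_univ 0) (mem_univ 1)]
  have hmk : ∀ (z : M) (hz : z = y), IsEdgelike (Path.Homotopic.Quotient.mk (γ.cast hz rfl)) →
      IsEdgelike (Path.Homotopic.Quotient.mk γ) := by
    rintro _ rfl h
    exact h
  refine hmk (γ 0) γ.source ?_
  have : rest 0 = γ.cast γ.source rfl := by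
    refine Path.ext (funext fun s => ?_)
    change γ.subpath 0 1 s = γ s
    rw [Path.subpath_zero_one]
    rfl
  rw [← this]
  exact h0

/-- Every homotopy class of paths between vertices is represented by an edge path. -/
theorem exists_edgePath {v w : T.vertices} (a : Path.Homotopic.Quotient (v : M) (w : M)) :
    ∃ p : T.EdgePath v w, p.homotopyClass = a := by
  induction a using Path.Homotopic.Quotient.ind with | mk γ =>
  obtain ⟨t, x, hx, c, h⟩ := isEdgelike_mk γ
  obtain ⟨_, s, d, rfl⟩ := v
  obtain ⟨u, hu, q, hq⟩ := h.of_cell_eq (t' := s) (x' := d.point) rfl d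
  obtain rfl : ⟨_, s, d, rfl⟩ = u := Subtype.ext hu
  refine ⟨q, ?_⟩
  rw [hq, T.cellPath_self, Path.Homotopic.Quotient.refl_trans]

end IdealTriangulation

/-! ### Uniqueness of compatible cocycles and representations -/

section PathAlgebra

variable {M : Type*} [TopologicalSpace M] {x y z w : M}

theorem quotient_trans_symm_trans (a : Path.Homotopic.Quotient x y)
    (b : Path.Homotopic.Quotient x z) : a.trans (a.symm.trans b) = b := by
  rw [← Path.Homotopic.Quotient.trans_assoc, Path.Homotopic.Quotient.trans_symm,
    Path.Homotopic.Quotient.refl_trans]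

theorem quotient_symm_trans_trans (a : Path.Homotopic.Quotient x y)
    (b : Path.Homotopic.Quotient y z) : a.symm.trans (a.trans b) = b := by
  rw [← Path.Homotopic.Quotient.trans_assoc, Path.Homotopic.Quotient.symm_trans,
    Path.Homotopic.Quotient.refl_trans]

theorem ofLoop_conj_trans (a : Path.Homotopic.Quotient x y) (b : Path.Homotopic.Quotient x z)
    (c : Path.Homotopic.Quotient x w) (d : Path.Homotopic.Quotient y z)
    (e : Path.Homotopic.Quotient z w) :
    PiOne.ofLoop ((a.trans (d.trans e)).trans c.symm) =
      PiOne.ofLoop ((a.trans d).trans b.symm) * PiOne.ofLoop ((b.trans e).trans c.symm) := by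
  rw [← PiOne.ofLoop_trans]
  simp only [Path.Homotopic.Quotient.trans_assoc, quotient_symm_trans_trans]

end PathAlgebra

namespace IdealTriangulation

variable {M : Type*} [TopologicalSpace M] (T : IdealTriangulation M)

/-- A vertex as a point of the boundary. -/
def boundaryVertex (v : T.vertices) : T.boundary := ⟨v, T.vertices_subset_boundary v.2⟩

/-- A straight path in a triangular face. -/
def boundaryPath {b b' : T.boundary} (t : Fin T.n) (k : Fin 4) (x y : TruncatedSimplex)
    (hx : T.cell t x = b) (hy : T.cell t y = b') (hxk : x.1 k = 2 / 3) (hyk : y.1 k = 2 / 3) :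
    Path b b' where
  toFun s := ⟨T.cell t (straightPath x y s), t, _, k, by
    rw [straightPath_apply, hxk, hyk]; ring, rfl⟩
  continuous_toFun :=
    ((T.continuous_cell t).comp (straightPath x y).continuous).subtype_mk _
  source' := Subtype.ext (by rw [← hx]; simp)
  target' := Subtype.ext (by rw [← hy]; simp)

variable {T}

/-- Every ideal point is the ideal point of a vertex. -/
theorem exists_vertex_eq {x₀ : M} (p : IdealPoint T.boundary x₀) :
    ∃ (w : T.vertices) (c : Path.Homotopic.Quotient x₀ (w : M)),
      p = IdealPoint.mk (T.boundaryVertex w) c := by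
  obtain ⟨⟨⟨_, t, x, k, hk, rfl⟩, c⟩⟩ := p
  obtain ⟨i, hi⟩ := exists_ne k
  let d : Corner := ⟨k, i, hi.symm⟩
  refine ⟨T.vertex t d, c.trans (T.cellPath t x d.point rfl rfl), ?_⟩
  exact Quotient.sound (s := coverSetoid T.boundary x₀)
    ⟨.mk (T.boundaryPath t k x d.point rfl rfl hk d.point_near), rfl⟩

end IdealTriangulation

namespace BruhatCocycle

variable {M : Type*} [TopologicalSpace M] {T : IdealTriangulation M} (τ : BruhatCocycle T)

open FlatBundle

/-- The holonomy of the bundle along a homotopy class of paths between vertices. -/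
def hol {v w : T.vertices} (γ : Path.Homotopic.Quotient (v : M) (w : M)) : SL2C :=
  (exists_smul_eq (atVertex τ w) (transport γ (atVertex τ v))).choose

theorem hol_smul {v w : T.vertices} (γ : Path.Homotopic.Quotient (v : M) (w : M)) :
    τ.hol γ • atVertex τ w = transport γ (atVertex τ v) :=
  (exists_smul_eq (atVertex τ w) (transport γ (atVertex τ v))).choose_spec

theorem hol_homotopyClass {v w : T.vertices} (p : T.EdgePath v w) :
    τ.hol p.homotopyClass = τ.along p :=
  smul_left_cancel _ ((τ.hol_smul _).trans (transport_edgePath p))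

theorem hol_edge (e : OrientedEdge T.n) :
    τ.hol (v := T.source e) (w := T.target e) (.mk (T.edge e)) = τ.label e :=
  smul_left_cancel _ ((τ.hol_smul _).trans (transport_edge e))

theorem hol_trans {u v w : T.vertices} (γ : Path.Homotopic.Quotient (u : M) (v : M))
    (δ : Path.Homotopic.Quotient (v : M) (w : M)) : τ.hol (γ.trans δ) = τ.hol γ * τ.hol δ := by
  refine smul_left_cancel (atVertex τ w) ?_
  rw [hol_smul, transport_trans, ← hol_smul, transport_smul, ← hol_smul, mul_smul]

theorem hol_refl (v : T.vertices) : τ.hol (.refl (v : M) : Path.Homotopic.Quotient (v : M) v) = 1 :=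
  smul_left_cancel (atVertex τ v) (by rw [hol_smul, transport_refl, one_smul])

theorem hol_symm {v w : T.vertices} (γ : Path.Homotopic.Quotient (v : M) (w : M)) :
    τ.hol γ.symm = (τ.hol γ)⁻¹ := by
  rw [eq_inv_iff_mul_eq_one, ← hol_trans, Path.Homotopic.Quotient.symm_trans, hol_refl]

variable {τ}

/-- Compatibility does not depend on the choice of a vertex and of a path to it, and it concerns
all homotopy classes of paths between vertices. -/
theorem IsCompatible.exists_conjugator {x₀ : M} {X : DecoratedRep T.boundary x₀}
    (h : τ.IsCompatible X) {v : T.vertices} (c : Path.Homotopic.Quotient x₀ (v : M)) :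
    ∃ g : SL2C, (∀ γ : Path.Homotopic.Quotient (v : M) v,
      X.ρ (PiOne.ofLoop ((c.trans γ).trans c.symm)) = g * τ.hol γ * g⁻¹) ∧
      ∀ (w : T.vertices) (γ : Path.Homotopic.Quotient (v : M) w),
        X.D (IdealPoint.mk (T.boundaryVertex w) (c.trans γ)) =
          ((g * τ.hol γ : SL2C) : SL2C ⧸ P) := by
  obtain ⟨v₀, c₀, g₀, h1, h2⟩ := h
  let δ : Path.Homotopic.Quotient (v₀ : M) v := c₀.symm.trans c
  have hδ : c₀.trans δ = c := quotient_trans_symm_trans c₀ c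
  clear_value δ
  refine ⟨g₀ * τ.hol δ, fun γ => ?_, fun w γ => ?_⟩
  · obtain ⟨p, hp⟩ := IdealTriangulation.exists_edgePath ((δ.trans γ).trans δ.symm)
    have h3 := h1 p
    rw [← hol_homotopyClass, hp, hol_trans, hol_trans, hol_symm] at h3
    have h4 : (c₀.trans ((δ.trans γ).trans δ.symm)).trans c₀.symm =
        (c.trans γ).trans c.symm := by
      have h5 : δ.symm.trans c₀.symm = c.symm := by
        have h6 : c.trans (δ.symm.trans c₀.symm) = .refl x₀ := by
          rw [← hδ, Path.Homotopic.Quotient.trans_assoc c₀,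
            quotient_trans_symm_trans δ c₀.symm, Path.Homotopic.Quotient.trans_symm]
        rw [← quotient_symm_trans_trans c (δ.symm.trans c₀.symm), h6,
          Path.Homotopic.Quotient.trans_refl]
      rw [Path.Homotopic.Quotient.trans_assoc c₀, Path.Homotopic.Quotient.trans_assoc _ _ c₀.symm,
        h5, Path.Homotopic.Quotient.trans_assoc δ, ← Path.Homotopic.Quotient.trans_assoc c₀, hδ,
        Path.Homotopic.Quotient.trans_assoc c]
    rw [← h4, h3]
    group
  · obtain ⟨p, hp⟩ := IdealTriangulation.exists_edgePath (δ.trans γ)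
    have h3 := h2 w p
    rw [← hol_homotopyClass, hp, hol_trans, ← Path.Homotopic.Quotient.trans_assoc, hδ,
      MulAction.Quotient.smul_coe, smul_eq_mul, ← mul_assoc] at h3
    exact h3

theorem nonempty_vertices (T : IdealTriangulation M) (x₀ : M) : Nonempty T.vertices := by
  obtain ⟨⟨t, _⟩, -⟩ := T.cell_surjective x₀
  exact ⟨T.vertex t ⟨0, 1, by decide⟩⟩

theorem IsCompatible.rep_equiv [PathConnectedSpace M] {x₀ : M}
    {X X' : DecoratedRep T.boundary x₀} (h : τ.IsCompatible X) (h' : τ.IsCompatible X') :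
    X ≈ X' := by
  obtain ⟨v⟩ := nonempty_vertices T x₀
  let c : Path.Homotopic.Quotient x₀ (v : M) := .mk (PathConnectedSpace.somePath x₀ v)
  obtain ⟨g, h1, h2⟩ := h.exists_conjugator c
  obtain ⟨g', h1', h2'⟩ := h'.exists_conjugator c
  refine ⟨g' * g⁻¹, fun a => ?_, fun p => ?_⟩
  · have ha : a = PiOne.ofLoop ((c.trans ((c.symm.trans a.loop).trans c)).trans c.symm) := by
      simp only [Path.Homotopic.Quotient.trans_assoc, quotient_trans_symm_trans,
        Path.Homotopic.Quotient.trans_symm, Path.Homotopic.Quotient.trans_refl]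
      rfl
    rw [ha, h1, h1']
    group
  · obtain ⟨w, b, rfl⟩ := IdealTriangulation.exists_vertex_eq p
    have hb : ∀ Y : DecoratedRep T.boundary x₀,
        Y.D (IdealPoint.mk (T.boundaryVertex w) (c.trans (c.symm.trans b))) =
          Y.D (IdealPoint.mk (T.boundaryVertex w) b) := fun Y =>
      congrArg (fun a : Path.Homotopic.Quotient x₀ (w : M) =>
        Y.D (IdealPoint.mk (T.boundaryVertex w) a)) (quotient_trans_symm_trans c b)
    refine (hb X').symm.trans ((h2' w (c.symm.trans b)).trans (Eq.trans ?_
      (congrArg (fun δ : SL2C ⧸ P => (g' * g⁻¹) • δ)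
        ((h2 w (c.symm.trans b)).symm.trans (hb X)))))
    rw [MulAction.Quotient.smul_coe, smul_eq_mul, ← mul_assoc, inv_mul_cancel_right]

theorem IsCompatible.cocycle_equiv [PathConnectedSpace M] {x₀ : M}
    {X : DecoratedRep T.boundary x₀} {τ' : BruhatCocycle T} (h : τ.IsCompatible X)
    (h' : τ'.IsCompatible X) : τ ≈ τ' := by
  obtain ⟨v⟩ := nonempty_vertices T x₀
  let c : Path.Homotopic.Quotient x₀ (v : M) := .mk (PathConnectedSpace.somePath x₀ v)
  obtain ⟨g, h1, h2⟩ := h.exists_conjugator c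
  obtain ⟨g', h1', h2'⟩ := h'.exists_conjugator c
  let γ : ∀ w : T.vertices, Path.Homotopic.Quotient (v : M) (w : M) :=
    fun w => .mk (PathConnectedSpace.somePath _ _)
  refine ⟨fun w => ⟨(g * τ.hol (γ w))⁻¹ * (g' * τ'.hol (γ w)), ?_⟩, fun e => ?_⟩
  · rw [← QuotientGroup.eq, ← h2, ← h2']
  · let E : Path.Homotopic.Quotient (T.source e : M) (T.target e) := .mk (T.edge e)
    have h3 := (h1 (((γ _).trans E).trans (γ _).symm)).symm.trans (h1' _)
    simp only [hol_trans, hol_symm, E, hol_edge] at h3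
    dsimp only
    have h4 : τ'.label e = (g' * τ'.hol (γ (T.source e)))⁻¹ * (g' * (τ'.hol (γ (T.source e)) *
        τ'.label e * (τ'.hol (γ (T.target e)))⁻¹) * g'⁻¹) * (g' * τ'.hol (γ (T.target e))) := by
      group
    rw [h4, ← h3]
    group

theorem IsCompatible.of_rep_equiv {x₀ : M} {X X' : DecoratedRep T.boundary x₀}
    (h : τ.IsCompatible X) (hX : X ≈ X') : τ.IsCompatible X' := by
  obtain ⟨v, c, g, h1, h2⟩ := h
  obtain ⟨k, hk, hk'⟩ := hX
  refine ⟨v, c, k * g, fun p => ?_, fun w p => ?_⟩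
  · rw [hk, h1]
    group
  · rw [hk', h2, mul_smul]

theorem along_of_equiv {τ τ' : BruhatCocycle T} {η : T.vertices → P}
    (h : ∀ e, τ'.label e = (η (T.source e) : SL2C)⁻¹ * τ.label e * (η (T.target e) : SL2C))
    {v w : T.vertices} (p : T.EdgePath v w) :
    τ'.along p = (η v : SL2C)⁻¹ * τ.along p * (η w : SL2C) := by
  induction p with
  | nil v => simp [along]
  | cons e h' p ih =>
    subst h'
    rw [along, along, h, ih]
    group

theorem IsCompatible.of_cocycle_equiv {x₀ : M} {X : DecoratedRep T.boundary x₀}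
    {τ' : BruhatCocycle T} (h : τ.IsCompatible X) (hτ : τ ≈ τ') : τ'.IsCompatible X := by
  obtain ⟨v, c, g, h1, h2⟩ := h
  obtain ⟨η, hη⟩ := hτ
  refine ⟨v, c, g * (η v : SL2C), fun p => ?_, fun w p => ?_⟩
  · rw [h1, along_of_equiv hη]
    group
  · rw [h2, along_of_equiv hη, MulAction.Quotient.smul_coe, MulAction.Quotient.smul_coe,
      QuotientGroup.eq, smul_eq_mul, smul_eq_mul]
    have : (g * τ.along p)⁻¹ * (g * (η v : SL2C) * ((η v : SL2C)⁻¹ * τ.along p * (η w : SL2C))) =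
        η w := by group
    rw [this]
    exact (η w).2

end BruhatCocycle

/-! ### Normalizing the representatives of cosets -/

/-- Two cosets of `P` have representatives `a`, `b` such that `a⁻¹ R b` is diagonal or
counter-diagonal; this is the Bruhat decomposition. -/
theorem exists_bruhat_representatives (δ δ' : SL2C ⧸ P) (R : SL2C) :
    ∃ a b : SL2C, (a : SL2C ⧸ P) = δ ∧ (b : SL2C ⧸ P) = δ' ∧
      (IsDiagonal (a⁻¹ * R * b) ∨ IsCounterDiagonal (a⁻¹ * R * b)) := by
  obtain ⟨a, rfl⟩ := QuotientGroup.mk_surjective δ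
  obtain ⟨b, rfl⟩ := QuotientGroup.mk_surjective δ'
  suffices h : ∀ g : SL2C, ∃ p ∈ P, ∃ q ∈ P,
      IsDiagonal (p * g * q) ∨ IsCounterDiagonal (p * g * q) by
    obtain ⟨p, hp, q, hq, h⟩ := h (a⁻¹ * R * b)
    refine ⟨a * p⁻¹, b * q, ?_, ?_, ?_⟩
    · rw [QuotientGroup.eq]; simpa using hp
    · rw [QuotientGroup.eq]; simpa using inv_mem hq
    · have : (a * p⁻¹)⁻¹ * R * (b * q) = p * (a⁻¹ * R * b) * q := by group
      rw [this]; exact h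
  have hmul : ∀ (g h : SL2C) (i j : Fin 2), (g * h) i j = g i 0 * h 0 j + g i 1 * h 1 j :=
    fun g h i j => by
      change (g.1 * h.1) i j = _
      rw [Matrix.mul_apply, Fin.sum_univ_two]
  intro g
  let u : ℂ → SL2C := fun x => ⟨!![1, x; 0, 1], by simp [Matrix.det_fin_two]⟩
  have hu : ∀ x, u x ∈ P := fun x => by
    refine ⟨?_, ?_, ?_⟩ <;> simp [u]
  have hu00 : ∀ x, u x 0 0 = 1 := fun x => rfl
  have hu01 : ∀ x, u x 0 1 = x := fun x => rfl
  have hu10 : ∀ x, u x 1 0 = 0 := fun x => rfl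
  have hu11 : ∀ x, u x 1 1 = 1 := fun x => rfl
  have hdet : g 0 0 * g 1 1 - g 0 1 * g 1 0 = 1 := by
    rw [← Matrix.det_fin_two]; exact g.2
  by_cases hc : g 1 0 = 0
  · refine ⟨1, one_mem _, u (-(g 0 1) / g 0 0), hu _, .inl ⟨?_, ?_⟩⟩
    · have ha : g 0 0 ≠ 0 := by
        rintro ha
        rw [ha, hc] at hdet
        simp at hdet
      rw [one_mul, hmul, hu01, hu11]
      field_simp
      ring
    · rw [one_mul, hmul, hu00, hu10, hc]
      ring
  · refine ⟨u (-(g 0 0) / g 1 0), hu _, u (-(g 1 1) / g 1 0), hu _, .inr ⟨?_, ?_⟩⟩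
    · simp only [hmul, hu00, hu01, hu10]
      field_simp
      ring
    · simp only [hmul, hu01, hu10, hu11]
      field_simp
      ring

theorem bruhat_inv {g : SL2C} (h : IsDiagonal g ∨ IsCounterDiagonal g) :
    IsDiagonal g⁻¹ ∨ IsCounterDiagonal g⁻¹ := by
  rcases h with ⟨h1, h2⟩ | ⟨h1, h2⟩
  · left
    rw [Matrix.SpecialLinearGroup.SL2_inv_expl g]
    exact ⟨by simp [h1], by simp [h2]⟩
  · right
    rw [Matrix.SpecialLinearGroup.SL2_inv_expl g]
    exact ⟨by simp [h2], by simp [h1]⟩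

/-- If cosets are assigned to the elements of a set with a fixed-point-free involution, their
representatives can be chosen such that those at each pair of opposite elements differ by a diagonal
or a counter-diagonal element. -/
theorem exists_representatives {V : Type*} (opp : V → V) (hopp : ∀ w, opp (opp w) = w)
    (hne : ∀ w, opp w ≠ w) (K : V → SL2C) (hK : ∀ w, K (opp w) = (K w)⁻¹) (δ : V → SL2C ⧸ P) :
    ∃ g : V → SL2C, ∀ w, (g w : SL2C ⧸ P) = δ w ∧
      (IsDiagonal ((g w)⁻¹ * K w * g (opp w)) ∨
        IsCounterDiagonal ((g w)⁻¹ * K w * g (opp w))) := by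
  classical
  choose a b ha hb hab using fun w => exists_bruhat_representatives (δ w) (δ (opp w)) (K w)
  -- one of the two elements of each pair is selected by means of a well-ordering
  refine ⟨fun w => if WellOrderingRel w (opp w) then a w else b (opp w), fun w => ⟨?_, ?_⟩⟩
  · dsimp only
    split_ifs
    · exact ha w
    · rw [hb, hopp]
  · dsimp only
    rw [hopp]
    by_cases h : WellOrderingRel w (opp w)
    · have h' : ¬ WellOrderingRel (opp w) w := fun h' => asymm h h'
      rw [if_pos h, if_neg h']
      exact hab w
    · have h' : WellOrderingRel (opp w) w := by
        rcases trichotomous_of WellOrderingRel w (opp w) with h1 | h1 | h1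
        · exact (h h1).elim
        · exact (hne w h1.symm).elim
        · exact h1
      rw [if_neg h, if_pos h']
      have h1 := bruhat_inv (hab (opp w))
      rw [hK] at h1
      have h2 : ((a (opp w))⁻¹ * (K w)⁻¹ * b (opp w))⁻¹ =
          (b (opp w))⁻¹ * K w * a (opp w) := by group
      rwa [h2] at h1

/-! ### The cocycle of a decorated representation -/

namespace IdealTriangulation

variable {M : Type*} [TopologicalSpace M] {T : IdealTriangulation M}

theorem vertex_surjective (w : T.vertices) : ∃ t c, T.vertex t c = w := by
  obtain ⟨_, t, c, rfl⟩ := w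
  exact ⟨t, c, rfl⟩

theorem edge_apply_eq_of_edgeGlued {e e' : OrientedEdge T.n} (h : T.pairing.EdgeGlued e e')
    (s : unitInterval) : T.edge e s = T.edge e' s := by
  have key : ∀ (t : Fin T.n) (c d : Corner) (f : Fin 4), f ≠ c.near → f ≠ c.dir → f ≠ d.near →
      f ≠ d.dir → T.cell t (straightPath c.point d.point s) =
        T.cell (T.pairing.adj t f) (straightPath (c.map (T.pairing.perm t f)).point
          (d.map (T.pairing.perm t f)).point s) := by
    intro t c d f h1 h2 h3 h4
    rw [← Corner.permPoint_point, ← Corner.permPoint_point, ← permPoint_straightPath]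
    refine (T.cell_glue f (t, straightPath c.point d.point s) ?_).symm
    rw [straightPath_apply, (c.point_eq_zero_iff f).2 ⟨h1, h2⟩,
      (d.point_eq_zero_iff f).2 ⟨h3, h4⟩]
    simp
  cases h with
  | long t f i j hi hj hij => exact key t ⟨i, j, hij⟩ ⟨j, i, hij.symm⟩ f hi hj hj hi
  | short t f k i j hk hi hj hki hkj hij => exact key t ⟨k, i, hki⟩ ⟨k, j, hkj⟩ f hk hi hk hj

theorem source_eq_of_edgeGlued {e e' : OrientedEdge T.n} (h : T.pairing.EdgeGlued e e') :
    T.source e = T.source e' :=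
  Subtype.ext (by simpa using edge_apply_eq_of_edgeGlued h 0)

theorem target_eq_of_edgeGlued {e e' : OrientedEdge T.n} (h : T.pairing.EdgeGlued e e') :
    T.target e = T.target e' :=
  Subtype.ext (by simpa using edge_apply_eq_of_edgeGlued h 1)

end IdealTriangulation

namespace DecoratedRep

variable {M : Type*} [TopologicalSpace M] {T : IdealTriangulation M} {x₀ : M}
  (X : DecoratedRep T.boundary x₀) (c : ∀ w : T.vertices, Path.Homotopic.Quotient x₀ (w : M))

/-- The extension of a representation to classes of paths between vertices, by means of a choice of
paths from the base point to the vertices. -/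
def extend {v w : T.vertices} (γ : Path.Homotopic.Quotient (v : M) (w : M)) : SL2C :=
  X.ρ (PiOne.ofLoop (((c v).trans γ).trans (c w).symm))

theorem extend_trans {u v w : T.vertices} (γ : Path.Homotopic.Quotient (u : M) (v : M))
    (δ : Path.Homotopic.Quotient (v : M) (w : M)) :
    X.extend c (γ.trans δ) = X.extend c γ * X.extend c δ := by
  rw [extend, extend, extend, ← map_mul, ← ofLoop_conj_trans]

theorem extend_refl (v : T.vertices) :
    X.extend c (.refl (v : M) : Path.Homotopic.Quotient (v : M) v) = 1 := by
  rw [extend, Path.Homotopic.Quotient.trans_refl, Path.Homotopic.Quotient.trans_symm]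
  exact map_one X.ρ

theorem extend_congr {v v' w w' : T.vertices} (hv : v = v') (hw : w = w') {γ : Path (v : M) (w : M)}
    {γ' : Path (v' : M) (w' : M)} (h : ∀ s, γ s = γ' s) :
    X.extend c (.mk γ) = X.extend c (.mk γ') := by
  subst hv hw
  obtain rfl : γ = γ' := Path.ext (funext h)
  rfl

/-- The value of the extended representation on the straight path between two corners of a
simplex. -/
def extendCorner (t : Fin T.n) (d d' : Corner) : SL2C :=
  X.extend c (v := T.vertex t d) (w := T.vertex t d') (T.cellPath t d.point d'.point rfl rfl)

theorem extendCorner_trans (t : Fin T.n) (d d' d'' : Corner) :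
    X.extendCorner c t d d' * X.extendCorner c t d' d'' = X.extendCorner c t d d'' :=
  (X.extend_trans c (u := T.vertex t d) (v := T.vertex t d') (w := T.vertex t d'') _ _).symm.trans
    (congrArg (X.extend c (v := T.vertex t d) (w := T.vertex t d''))
      (T.cellPath_trans t _ _ _ _ _ _))

theorem extendCorner_self (t : Fin T.n) (d : Corner) : X.extendCorner c t d d = 1 :=
  mul_eq_left.1 (X.extendCorner_trans c t d d d)

theorem extend_edge (e : OrientedEdge T.n) :
    X.extend c (.mk (T.edge e)) = X.extendCorner c e.tet e.source e.target := rfl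

theorem extendCorner_eq_of_edgeGlued {e e' : OrientedEdge T.n} (h : T.pairing.EdgeGlued e e') :
    X.extendCorner c e.tet e.source e.target = X.extendCorner c e'.tet e'.source e'.target :=
  X.extend_congr c (IdealTriangulation.source_eq_of_edgeGlued h)
    (IdealTriangulation.target_eq_of_edgeGlued h) (IdealTriangulation.edge_apply_eq_of_edgeGlued h)

/-- The coset assigned to the ideal point near a vertex. -/
def cosetAt (w : T.vertices) : SL2C ⧸ P := X.D (IdealPoint.mk (T.boundaryVertex w) (c w))

theorem D_trans {v w : T.vertices} (γ : Path.Homotopic.Quotient (v : M) (w : M)) :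
    X.D (IdealPoint.mk (T.boundaryVertex w) ((c v).trans γ)) = X.extend c γ • X.cosetAt c w := by
  rw [extend, cosetAt, ← X.equivariant]
  have h : (c v).trans γ = (((c v).trans γ).trans (c w).symm).trans (c w) := by
    rw [Path.Homotopic.Quotient.trans_assoc _ (c w).symm, Path.Homotopic.Quotient.symm_trans,
      Path.Homotopic.Quotient.trans_refl]
  exact congrArg (fun a : Path.Homotopic.Quotient x₀ (w : M) =>
    X.D (IdealPoint.mk (T.boundaryVertex w) a)) h

theorem cosetAt_eq_of_short (t : Fin T.n) {d d' : Corner} (h : d.near = d'.near) :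
    X.cosetAt c (T.vertex t d) = X.extendCorner c t d d' • X.cosetAt c (T.vertex t d') := by
  rw [extendCorner, ← D_trans, cosetAt]
  congr 1
  exact Quotient.sound (s := coverSetoid T.boundary x₀)
    ⟨.mk (T.boundaryPath t d.near d.point d'.point rfl rfl d.point_near (by rw [h]; simp)), rfl⟩

/-- The vertices are the ends of the long edges, each of exactly one of them, so that the
representatives of `exists_representatives` are available for the cosets at the vertices. -/
theorem exists_cosetAt_representatives : ∃ g : T.vertices → SL2C,
    (∀ w, (g w : SL2C ⧸ P) = X.cosetAt c w) ∧
    ∀ (t : Fin T.n) (d : Corner),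
      let R := (g (T.vertex t d))⁻¹ * X.extendCorner c t d d.swap * g (T.vertex t d.swap)
      IsDiagonal R ∨ IsCounterDiagonal R := by
  choose t d htd using T.vertex_surjective
  let K : Fin T.n → Corner → SL2C := fun t d => X.extendCorner c t d d.swap
  have hK : ∀ {t t' d d'}, T.vertex t d = T.vertex t' d' →
      T.vertex t d.swap = T.vertex t' d'.swap ∧ K t d = K t' d' := by
    intro t t' d d' h
    refine T.corner_induction (C := fun s b => T.vertex t d.swap = T.vertex s b.swap ∧
      K t d = K s b) ?_ (congrArg Subtype.val h) ⟨rfl, rfl⟩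
    rintro s b f h1 h2 ⟨h3, h4⟩
    have hg := IdealTriangulation.edgeGlued_longEdge s b f h1 h2
    have h5 := X.extendCorner_eq_of_edgeGlued c hg
    exact ⟨h3.trans (IdealTriangulation.target_eq_of_edgeGlued hg), h4.trans h5⟩
  let opp : T.vertices → T.vertices := fun w => T.vertex (t w) (d w).swap
  have hopp : ∀ s b, opp (T.vertex s b) = T.vertex s b.swap := fun s b =>
    (hK (htd (T.vertex s b))).1
  have hK' : ∀ s b, K (t (T.vertex s b)) (d (T.vertex s b)) = K s b := fun s b =>
    (hK (htd (T.vertex s b))).2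
  have hinv : ∀ s b, K s b.swap = (K s b)⁻¹ := fun s b => by
    rw [eq_inv_iff_mul_eq_one]
    exact (X.extendCorner_trans c s b.swap b b.swap).trans (X.extendCorner_self c _ _)
  obtain ⟨g, hg⟩ := exists_representatives opp
    (fun w => by
      have h := hopp (t w) (d w).swap
      rw [Corner.swap_swap, htd] at h
      exact h)
    (fun w h => IdealTriangulation.cell_swap_ne (t w) (d w)
      (congrArg Subtype.val ((htd w).trans h.symm)))
    (fun w => K (t w) (d w)) (fun w => (hK' (t w) (d w).swap).trans (hinv _ _))
    (X.cosetAt c)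
  refine ⟨g, fun w => (hg w).1, fun s b => ?_⟩
  have h := (hg (T.vertex s b)).2
  rw [hK', hopp] at h
  exact h

/-- Every decorated representation is compatible with a Bruhat cocycle: the values of the
representation on the edges, in terms of suitable representatives of the cosets. -/
theorem exists_cocycle [PathConnectedSpace M] : ∃ τ : BruhatCocycle T, τ.IsCompatible X := by
  let c : ∀ w : T.vertices, Path.Homotopic.Quotient x₀ (w : M) :=
    fun w => .mk (PathConnectedSpace.somePath _ _)
  obtain ⟨g, hg, hlong⟩ := X.exists_cosetAt_representatives c
  let r : Fin T.n → Corner → Corner → SL2C := fun t d d' =>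
    (g (T.vertex t d))⁻¹ * X.extendCorner c t d d' * g (T.vertex t d')
  have hr : ∀ t d d' d'', r t d d' * r t d' d'' = r t d d'' := by
    intro t d d' d''
    simp only [r]
    rw [← X.extendCorner_trans c t d d' d'']
    group
  have hr1 : ∀ t d, r t d d = 1 := fun t d => mul_eq_left.1 (hr t d d d)
  let τ : BruhatCocycle T :=
    { label := fun e => r e.tet e.source e.target
      label_glued := by
        intro e e' h
        change (g (T.source e))⁻¹ * _ * g (T.target e) = (g (T.source e'))⁻¹ * _ * g (T.target e')
        rw [IdealTriangulation.source_eq_of_edgeGlued h,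
          IdealTriangulation.target_eq_of_edgeGlued h, X.extendCorner_eq_of_edgeGlued c h]
      label_reverse := by
        intro e
        rw [eq_inv_iff_mul_eq_one]
        cases e with
        | long t i j hij => exact (hr t _ _ _).trans (hr1 t _)
        | short t k i j hki hkj hij => exact (hr t _ _ _).trans (hr1 t _)
      triangle := by
        intro t k i j l hki hkj hkl hij hjl hli
        simp only [OrientedEdge.tet, OrientedEdge.source, OrientedEdge.target, hr, hr1]
      hexagon := by
        intro t i j k hij hjk hki
        simp only [OrientedEdge.tet, OrientedEdge.source, OrientedEdge.target, hr, hr1]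
      short_mem := by
        intro t k i j hki hkj hij
        have h := X.cosetAt_eq_of_short c t (d := ⟨k, i, hki⟩) (d' := ⟨k, j, hkj⟩) rfl
        rw [← hg, ← hg, MulAction.Quotient.smul_coe, QuotientGroup.eq, smul_eq_mul,
          ← mul_assoc] at h
        exact h
      long_mem := fun t i j hij => hlong t ⟨i, j, hij⟩ }
  have halong : ∀ {v w : T.vertices} (p : T.EdgePath v w),
      X.extend c p.homotopyClass = g v * τ.along p * (g w)⁻¹ := by
    intro v w p
    induction p with
    | nil v =>
      rw [IdealTriangulation.EdgePath.homotopyClass, extend_refl, BruhatCocycle.along]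
      simp
    | cons e h p ih =>
      subst h
      rw [IdealTriangulation.EdgePath.homotopyClass, Path.Homotopic.Quotient.cast_rfl_rfl,
        extend_trans, ih, BruhatCocycle.along, extend_edge]
      change X.extendCorner c e.tet e.source e.target * (g (T.target e) * _ * _) =
        g (T.source e) * ((g (T.source e))⁻¹ * X.extendCorner c e.tet e.source e.target *
          g (T.target e) * _) * _
      group
  obtain ⟨v⟩ := BruhatCocycle.nonempty_vertices T x₀
  refine ⟨τ, v, c v, g v, fun p => halong p, fun w p => ?_⟩
  refine (X.D_trans c p.homotopyClass).trans ?_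
  rw [halong, ← hg, MulAction.Quotient.smul_coe, MulAction.Quotient.smul_coe, smul_eq_mul,
    smul_eq_mul, inv_mul_cancel_right]

end DecoratedRep

end Ptolemy

end

theorem theorem5p3 {M : Type*} [TopologicalSpace M] [ConnectedSpace M]
    (T : Ptolemy.IdealTriangulation M) (x₀ : M) :
    ∃ Φ : Quotient (Ptolemy.decoratedRepSetoid T.boundary x₀) ≃
        Quotient (Ptolemy.bruhatSetoid T),
      ∀ (X : Ptolemy.DecoratedRep T.boundary x₀) (τ : Ptolemy.BruhatCocycle T),
        Φ (Quotient.mk _ X) = Quotient.mk _ τ ↔ τ.IsCompatible X := by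
  have := T.pathConnectedSpace
  choose F hF using fun X : Ptolemy.DecoratedRep T.boundary x₀ => X.exists_cocycle
  let Φ : Quotient (Ptolemy.decoratedRepSetoid T.boundary x₀) →
      Quotient (Ptolemy.bruhatSetoid T) :=
    Quotient.lift (fun X => Quotient.mk _ (F X)) fun X X' h =>
      Quotient.sound (((hF X).of_rep_equiv h).cocycle_equiv (hF X'))
  have hΦ : ∀ (X : Ptolemy.DecoratedRep T.boundary x₀) (τ : Ptolemy.BruhatCocycle T),
      Φ (Quotient.mk _ X) = Quotient.mk _ τ ↔ τ.IsCompatible X := fun X τ =>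
    ⟨fun h => (hF X).of_cocycle_equiv (Quotient.exact h),
      fun h => Quotient.sound ((hF X).cocycle_equiv h)⟩
  refine ⟨Equiv.ofBijective Φ ⟨?_, ?_⟩, hΦ⟩
  · rintro ⟨X⟩ ⟨X'⟩ h
    exact Quotient.sound (((hΦ X (F X')).1 h).rep_equiv (hF X'))
  · rintro ⟨τ⟩
    obtain ⟨X, hX⟩ := τ.exists_decoratedRep x₀
    exact ⟨Quotient.mk _ X, (hΦ X τ).2 hX⟩
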